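/- Let $n,d,m$ be positive integers and $\mathbb S=\{1,\dots,m\}$. On a probability space let $B$ be a $d$-dimensional Brownian motion and $r$ a right-continuous Markov chain on $\mathbb S$ with $r(0)=\ell$, independent of $B$, with generator $\Gamma=(\gamma_{ij})$ (so $\gamma_{ij}\ge 0$ for $i\ne j$, $\sum_j\gamma_{ij}=0$, and the transition matrices are $e^{t\Gamma}$). Assume that $\Gamma$ is irreducible, i.e. the system $\pi\Gamma=0$, $\sum_i\pi_i=1$ has a unique solution $\pi$, and $\pi_i>0$ for all $i$. Let $x_0\in\mathbb R^n$, and let $f(\cdot,i):\mathbb R^n\to\mathbb R^n$, $g(\cdot,i):\mathbb R^n\to\mathbb R^{n\times d}$, $i\in\mathbb S$, be locally Lipschitz. Write $|A|=\sqrt{\operatorname{trace}(A^TA)}$. Suppose that $f(0,i)=0$ and $g(0,i)=0$ for all $i$, and that there are $\rho>0$, a symmetric positive definite $Q\in\mathbb R^{n\times n}$ and $\beta=(\beta_1,\dots,\beta_m)\in\mathbb R^m$ such that, for all $x\in\mathbb R^n$ and $i\in\mathbb S$, $$(x^TQx)\,\psi(x,i)-(2-\rho)|x^TQg(x,i)|^2\le\beta_i(x^TQx)^2,\qquad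 \psi(x,i)=2x^TQf(x,i)+\operatorname{trace}\big(g(x,i)^TQg(x,i)\big),$$ and that $\sum_i\pi_i\beta_i<0$. For $p>0$ put $\eta_{p,\beta}=-\max\{\operatorname{Re}\nu:\nu\text{ an eigenvalue of }\Gamma+\tfrac p2\operatorname{diag}(\beta)\}$. Let $p^*_\beta=+\infty$ if $\max_i\beta_i\le 0$, and let $p^*_\beta$ be any number in $\big(0,\min_{i:\beta_i>0}(-2\gamma_{ii}/\beta_i)\big)$ if $\max_i\beta_i>0$. For each $i$ let $\varphi_i:[0,\infty)\to[0,\infty)$ be continuous, strictly increasing and unbounded with $$\sup_{|x|\vee|y|\le u,\ x\ne y}\Big(\frac{|f(x,i)-f(y,i)|}{|x-y|}\vee\frac{|g(x,i)-g(y,i)|^2}{|x-y|^2}\Big)\le\varphi_i(u)\qquad\text{for all }u\ge 1;$$ if this supremum is bounded in $u$, one may instead take for $\varphi_i$ a constant $C$ that bounds it, with the convention $\varphi_i^{-1}\equiv+\infty$ on $[C,\infty)$. Let $h:(0,1]\to[\max_i\varphi_i(|x_0|\vee1),\infty)$ be strictly decreasing with $h(1)\ge\max_i\{|f(0,i)|\vee|g(0,i)|^2\}$,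 $\lim_{\Delta\to0}h(\Delta)=\infty$, and $\Delta^{1/2-\theta}h(\Delta)\le K$ for all $\Delta\in(0,1]$, for some $\theta\in(0,\tfrac12)$ and $K>0$. For $\Delta\in(0,1]$ let $\pi^i_\Delta(x)=\big(|x|\wedge\varphi_i^{-1}(h(\Delta))\big)\,x/|x|$, with $\pi^i_\Delta(0)=0$, and define, with $r_k=r(k\Delta)$, the scheme $$\tilde Z_0=x_0,\qquad Z_k=\pi^{r_k}_\Delta(\tilde Z_k),\qquad \tilde Z_{k+1}=Z_k+f(Z_k,r_k)\Delta+g(Z_k,r_k)\big(B((k+1)\Delta)-B(k\Delta)\big),\qquad k\ge 0.$$ Then for every $p\in(0,p^*_\beta)\cap(0,\rho]$ and every $\varrho\in(0,\eta_{p,\beta})$ there is $\Delta^{**}\in(0,1]$ such that, for all $\Delta\in(0,\Delta^{**}]$, $$\limsup_{k\to\infty}\frac{\log\mathbb E|Z_k|^p}{k\Delta}\le-(\eta_{p,\beta}-\varrho)<0\qquad\text{and}\qquad\limsup_{k\to\infty}\frac{\log|Z_k|}{k\Delta}\le-\frac{\eta_{p,\beta}-\varrho}{p}\quad\text{almost surely},$$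 where $\log 0=-\infty$. -/

import Mathlib

open MeasureTheory ProbabilityTheory Filter Topology
open scoped NNReal ENNReal Matrix

noncomputable section

namespace SwitchingEM

/-- The trace norm `|A| = √(trace (Aᵀ A))` of a real matrix. -/
def traceNorm {n d : ℕ} (A : Matrix (Fin n) (Fin d) ℝ) : ℝ :=
  √((Aᵀ * A).trace)

/-- `Γ = (γ_ij)` is the generator of a Markov chain with finitely many states: `γ_ij ≥ 0` for
`i ≠ j`, and every row sums to zero. -/
structure IsGenerator {m : ℕ} (Γ : Matrix (Fin m) (Fin m) ℝ) : Prop where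
  nonneg : ∀ i j, i ≠ j → 0 ≤ Γ i j
  row_sum : ∀ i, ∑ j, Γ i j = 0

/-- `π` solves `π Γ = 0`, `∑ π_i = 1`. -/
def IsStationaryVector {m : ℕ} (Γ : Matrix (Fin m) (Fin m) ℝ) (π : Fin m → ℝ) : Prop :=
  π ᵥ* Γ = 0 ∧ ∑ i, π i = 1

/-- Irreducibility: the system `π Γ = 0`, `∑ π_i = 1` has a unique solution, and this solution
has positive entries. -/
def IsIrreducibleGenerator {m : ℕ} (Γ : Matrix (Fin m) (Fin m) ℝ) : Prop :=
  ∃ π : Fin m → ℝ, IsStationaryVector Γ π ∧ (∀ i, 0 < π i) ∧ ∀ π', IsStationaryVector Γ π' → π' = π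

/-- `r` is a right-continuous, time homogeneous Markov chain with generator `Γ`, started at `ℓ`:
its transition matrices are `P(t) = exp(t Γ)`, and its finite-dimensional distributions are
`P(r(t₀) = i₀, …, r(t_N) = i_N) = P(r(t₀) = i₀) P_{i₀ i₁}(t₁ - t₀) ⋯ P_{i_{N-1} i_N}(t_N - t_{N-1})`
for `t₀ ≤ t₁ ≤ … ≤ t_N`. -/
structure IsMarkovChain {Ω : Type*} [MeasurableSpace Ω] (P : Measure Ω) {m : ℕ}
    (Γ : Matrix (Fin m) (Fin m) ℝ) (ℓ : Fin m) (r : ℝ≥0 → Ω → Fin m) : Prop where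
  measurable : ∀ t, Measurable (r t)
  right_continuous : ∀ᵐ ω ∂P, ∀ t : ℝ≥0, ContinuousWithinAt (fun s => r s ω) (Set.Ici t) t
  initial : ∀ᵐ ω ∂P, r 0 ω = ℓ
  finite_dim : ∀ (N : ℕ) (t : Fin (N + 1) → ℝ≥0), Monotone t → ∀ i : Fin (N + 1) → Fin m,
    P.real {ω | ∀ k, r (t k) ω = i k} =
      P.real {ω | r (t 0) ω = i 0} *
        ∏ k : Fin N, NormedSpace.exp (((t k.succ : ℝ) - (t k.castSucc : ℝ)) • Γ)
          (i k.castSucc) (i k.succ)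

/-- `B` is a `d`-dimensional Brownian motion: its coordinates are independent real Brownian
motions started at `0`. -/
structure IsBrownianMotion {Ω : Type*} [MeasurableSpace Ω] (P : Measure Ω) {d : ℕ}
    (B : ℝ≥0 → Ω → EuclideanSpace ℝ (Fin d)) : Prop where
  measurable : ∀ t, Measurable (B t)
  coord : ∀ a : Fin d, IsBrownianReal (fun t ω => B t ω a) P
  indep : iIndepFun (fun (a : Fin d) (ω : Ω) (t : ℝ≥0) => B t ω a) P

/-- Local Lipschitz continuity of the coefficients, uniformly in the state `i`. -/
def IsLocallyLipschitz {n d m : ℕ}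
    (f : EuclideanSpace ℝ (Fin n) → Fin m → EuclideanSpace ℝ (Fin n))
    (g : EuclideanSpace ℝ (Fin n) → Fin m → Matrix (Fin n) (Fin d) ℝ) : Prop :=
  ∀ N : ℝ, 0 < N → ∃ C : ℝ, 0 < C ∧ ∀ x y : EuclideanSpace ℝ (Fin n), max ‖x‖ ‖y‖ ≤ N →
    ∀ i, max ‖f x i - f y i‖ (traceNorm (g x i - g y i)) ≤ C * ‖x - y‖

/-- The quadratic form `xᵀ Q x`. -/
def quad {n : ℕ} (Q : Matrix (Fin n) (Fin n) ℝ) (x : EuclideanSpace ℝ (Fin n)) : ℝ :=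
  x.ofLp ⬝ᵥ (Q *ᵥ x.ofLp)

/-- `ψ(x, i) = 2 xᵀ Q f(x, i) + trace (g(x, i)ᵀ Q g(x, i))`. -/
def psi {n d m : ℕ} (f : EuclideanSpace ℝ (Fin n) → Fin m → EuclideanSpace ℝ (Fin n))
    (g : EuclideanSpace ℝ (Fin n) → Fin m → Matrix (Fin n) (Fin d) ℝ)
    (Q : Matrix (Fin n) (Fin n) ℝ) (x : EuclideanSpace ℝ (Fin n)) (i : Fin m) : ℝ :=
  2 * (x.ofLp ⬝ᵥ (Q *ᵥ (f x i).ofLp)) + ((g x i)ᵀ * Q * g x i).trace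

/-- The assumption on the coefficients under which the trivial solution is stable:
`f(0, i) = 0`, `g(0, i) = 0`, `Q` is symmetric positive definite, `ρ > 0`, and
`(xᵀQx) ψ(x, i) - (2 - ρ) |xᵀ Q g(x, i)|² ≤ β_i (xᵀQx)²`. -/
structure StabilityAssumption {n d m : ℕ}
    (f : EuclideanSpace ℝ (Fin n) → Fin m → EuclideanSpace ℝ (Fin n))
    (g : EuclideanSpace ℝ (Fin n) → Fin m → Matrix (Fin n) (Fin d) ℝ)
    (Q : Matrix (Fin n) (Fin n) ℝ) (β : Fin m → ℝ) (ρ : ℝ) : Prop where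
  f_zero : ∀ i, f 0 i = 0
  g_zero : ∀ i, g 0 i = 0
  Q_posDef : Q.PosDef
  rho_pos : 0 < ρ
  bound : ∀ x i, quad Q x * psi f g Q x i
      - (2 - ρ) * ‖WithLp.toLp 2 (x.ofLp ᵥ* (Q * g x i))‖ ^ 2 ≤ β i * quad Q x ^ 2

/-- `η_{p,u} = - max {Re ν : ν an eigenvalue of Γ + (p/2) diag(u)}`. -/
def eta {m : ℕ} (Γ : Matrix (Fin m) (Fin m) ℝ) (p : ℝ) (u : Fin m → ℝ) : ℝ :=
  - sSup (Complex.re ''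
      spectrum ℂ ((Γ + (p / 2) • Matrix.diagonal u).map (fun a : ℝ => (a : ℂ))))

/-- The admissible values of the critical exponent `p*_u`: it is `+∞` if `max u_i ≤ 0`, and it
lies in the interval `(0, min {-2 γ_ii / u_i : u_i > 0})` if `max u_i > 0`. -/
def IsCriticalExponent {m : ℕ} (Γ : Matrix (Fin m) (Fin m) ℝ) (u : Fin m → ℝ)
    (pstar : EReal) : Prop :=
  ((∀ i, u i ≤ 0) → pstar = ⊤) ∧
    ((∃ i, 0 < u i) → 0 < pstar ∧
      ∀ i, 0 < u i → pstar < ((-2 * Γ i i / u i : ℝ) : EReal))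

/-- The functions `φ_i : [0, ∞) → [0, ∞)` that control the Lipschitz constants of the coefficients
on balls. Each `φ_i` is continuous, strictly increasing and unbounded; for a state in which the
coefficients are globally Lipschitz, `φ_i` may also be a constant (then that state is not
truncated, see `truncRadius`). -/
structure IsLipschitzControl {n d m : ℕ}
    (f : EuclideanSpace ℝ (Fin n) → Fin m → EuclideanSpace ℝ (Fin n))
    (g : EuclideanSpace ℝ (Fin n) → Fin m → Matrix (Fin n) (Fin d) ℝ)
    (φ : Fin m → ℝ → ℝ) : Prop where
  nonneg : ∀ i, ∀ u, 0 ≤ u → 0 ≤ φ i u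
  shape : ∀ i,
    (StrictMonoOn (φ i) (Set.Ici 0) ∧ ContinuousOn (φ i) (Set.Ici 0) ∧
      Tendsto (φ i) atTop atTop) ∨
    (∃ C : ℝ, ∀ u, 0 ≤ u → φ i u = C)
  bound : ∀ i, ∀ u, 1 ≤ u → ∀ x y : EuclideanSpace ℝ (Fin n), max ‖x‖ ‖y‖ ≤ u → x ≠ y →
    max (‖f x i - f y i‖ / ‖x - y‖) (traceNorm (g x i - g y i) ^ 2 / ‖x - y‖ ^ 2) ≤ φ i u

/-- The function `h : (0, 1] → [max_i φ_i(|x₀| ∨ 1), ∞)` that fixes the truncation level in terms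
of the stepsize. -/
structure IsTruncationLevel {n d m : ℕ}
    (f : EuclideanSpace ℝ (Fin n) → Fin m → EuclideanSpace ℝ (Fin n))
    (g : EuclideanSpace ℝ (Fin n) → Fin m → Matrix (Fin n) (Fin d) ℝ)
    (φ : Fin m → ℝ → ℝ) (x₀ : EuclideanSpace ℝ (Fin n)) (h : ℝ → ℝ) : Prop where
  range : ∀ Δ ∈ Set.Ioc (0 : ℝ) 1, ∀ i, φ i (max ‖x₀‖ 1) ≤ h Δ
  strictAnti : StrictAntiOn h (Set.Ioc 0 1)
  at_one : ∀ i, max ‖f 0 i‖ (traceNorm (g 0 i) ^ 2) ≤ h 1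
  tendsto : Tendsto h (𝓝[>] 0) atTop
  rate : ∃ θ : ℝ, 0 < θ ∧ θ < 1 / 2 ∧ ∃ K : ℝ, 0 < K ∧
    ∀ Δ ∈ Set.Ioc (0 : ℝ) 1, Δ ^ (1 / 2 - θ) * h Δ ≤ K

/-- The inverse function `φ⁻¹(v) ∈ [0, ∞]`, written as `sup {u ≥ 0 : φ(u) ≤ v}`. For `φ`
continuous, strictly increasing and unbounded and `v ≥ φ(0)` it is the usual inverse; for a
constant `φ = C ≤ v` it is `+∞`. -/
def truncRadius (φ : ℝ → ℝ) (v : ℝ) : ℝ≥0∞ :=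
  ⨆ (u : ℝ≥0) (_ : φ u ≤ v), (u : ℝ≥0∞)

/-- The truncation map `x ↦ (|x| ∧ R) x / |x|`, with `x / |x| = 0` for `x = 0`. -/
def trunc {n : ℕ} (R : ℝ≥0∞) (x : EuclideanSpace ℝ (Fin n)) : EuclideanSpace ℝ (Fin n) :=
  (min ‖x‖ₑ R).toReal • (‖x‖⁻¹ • x)

/-- The untruncated values `Z̃_k` of the scheme, for given values `r_k` of the chain and increments
`b_k` of the Brownian motion: `Z̃_0 = x₀` and, with `Z_k` the truncation of `Z̃_k` to the ball of
radius `φ_{r_k}⁻¹(h(Δ))`, `Z̃_{k+1} = Z_k + f(Z_k, r_k) Δ + g(Z_k, r_k) b_k`. -/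
def preScheme {n d m : ℕ}
    (f : EuclideanSpace ℝ (Fin n) → Fin m → EuclideanSpace ℝ (Fin n))
    (g : EuclideanSpace ℝ (Fin n) → Fin m → Matrix (Fin n) (Fin d) ℝ)
    (φ : Fin m → ℝ → ℝ) (h : ℝ → ℝ) (x₀ : EuclideanSpace ℝ (Fin n)) (Δ : ℝ)
    (r : ℕ → Fin m) (b : ℕ → EuclideanSpace ℝ (Fin d)) : ℕ → EuclideanSpace ℝ (Fin n)
  | 0 => x₀
  | k + 1 =>
    let Z := trunc (truncRadius (φ (r k)) (h Δ)) (preScheme f g φ h x₀ Δ r b k)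
    Z + Δ • f Z (r k) + WithLp.toLp 2 (g Z (r k) *ᵥ (b k).ofLp)

/-- The numerical solution `Z_k` with stepsize `Δ`, driven by `r_k = r(kΔ)` and the increments
`B((k+1)Δ) - B(kΔ)`. -/
def scheme {Ω : Type*} {n d m : ℕ}
    (f : EuclideanSpace ℝ (Fin n) → Fin m → EuclideanSpace ℝ (Fin n))
    (g : EuclideanSpace ℝ (Fin n) → Fin m → Matrix (Fin n) (Fin d) ℝ)
    (φ : Fin m → ℝ → ℝ) (h : ℝ → ℝ) (x₀ : EuclideanSpace ℝ (Fin n))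
    (r : ℝ≥0 → Ω → Fin m) (B : ℝ≥0 → Ω → EuclideanSpace ℝ (Fin d))
    (Δ : ℝ) (k : ℕ) (ω : Ω) : EuclideanSpace ℝ (Fin n) :=
  trunc (truncRadius (φ (r (k * Δ.toNNReal) ω)) (h Δ))
    (preScheme f g φ h x₀ Δ (fun j => r (j * Δ.toNNReal) ω)
      (fun j => B ((j + 1) * Δ.toNNReal) ω - B (j * Δ.toNNReal) ω) k)

end SwitchingEM

end

open SwitchingEM

/-! The Lyapunov function is `V(x) = (xᵀQx)^{p/2}`, and the proof separates the Gaussian noise from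
the chain.

One step. On the truncation ball the coefficients satisfy `|f| ≤ h(Δ)|x|` and `|g|² ≤ h(Δ)|x|²`, and
`Δ h(Δ) ≤ K ε` with `ε = Δ^{1/2+θ}`. Relative to `xᵀQx`, a step changes the quadratic form by an
even part of order `ε` and an odd part of order `√ε` in the Gaussian increment `b`. In the expansion
of `(1 + ξ)^{p/2}` a cubic term of order `ε^{3/2}` would not be `o(Δ)` for small `θ`. Averaging over
`b` and `-b` removes all odd terms and leaves an error `ε² = Δ^{1+2θ} = o(Δ)`. The terms of order
`Δ` are those in the stability assumption, since `p ≤ ρ`. Hence in state `i` the mean of `V` is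
multiplied by at most `a_i = 1 + (p/2) β_i Δ + C Δ^{1+2θ}` (`exists_lintegral_quad_rpow_le`). Radial
truncation only decreases `V`.

Many steps. Conditionally on the chain the factors multiply, so it remains to bound the mean of `∏
a_{r_j}` (`lintegral_scheme_le`). For every `λ > -η` there is a positive vector `ζ` with `(Γ + (p/2)
diag β) ζ ≤ λ ζ` (`exists_pos_mulVec_le`). For small `Δ` this gives `a_i (e^{ΔΓ} ζ)_i ≤ e^{λ'Δ} ζ_i`
with `λ'` slightly above `λ`, and summing out the last state of the path repeatedly yields decay
like `e^{λ'kΔ}` (`IsMarkovChain.integral_prod_le`). Summability of weighted moments turns this into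
almost sure decay (`ae_eventually_le_exp`). -/

noncomputable section

namespace SwitchingEM

/-! ### Superharmonic vectors of matrices with nonnegative off-diagonal entries. -/

section Metzler

attribute [local instance] Matrix.linftyOpNormedRing Matrix.linftyOpNormedAlgebra

/-- Gelfand's formula and the root test: eventually `‖a ^ k‖ ≤ q ^ k` for some `q < 1`. -/
theorem summable_norm_pow_of_spectralRadius_lt_one {A : Type*} [NormedRing A] [CompleteSpace A]
    [NormedAlgebra ℂ A] (a : A) (ha : spectralRadius ℂ a < 1) : Summable fun k : ℕ => ‖a ^ k‖ := by
  obtain ⟨q, hq, hq1⟩ := ENNReal.lt_iff_exists_nnreal_btwn.1 ha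
  have hq1' : (q : ℝ) < 1 := by exact_mod_cast hq1
  have h := (spectrum.pow_nnnorm_pow_one_div_tendsto_nhds_spectralRadius a).eventually
    (gt_mem_nhds hq)
  refine summable_of_isBigO_nat (summable_geometric_of_lt_one q.2 hq1') ?_
  refine Asymptotics.IsBigO.of_bound 1 ?_
  filter_upwards [h, eventually_gt_atTop 0] with k hk hk0
  have hk0' : (0 : ℝ) < k := by exact_mod_cast hk0
  have h2 : ((‖a ^ k‖₊ : ℝ≥0∞) ^ (1 / k : ℝ)) ^ (k : ℝ) ≤ (q : ℝ≥0∞) ^ (k : ℝ) :=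
    ENNReal.rpow_le_rpow hk.le hk0'.le
  rw [← ENNReal.rpow_mul, one_div_mul_cancel hk0'.ne', ENNReal.rpow_one, ENNReal.rpow_natCast] at h2
  have h3 : ‖a ^ k‖₊ ≤ q ^ k := by exact_mod_cast h2
  have h4 : ‖a ^ k‖ ≤ (q : ℝ) ^ k := by exact_mod_cast h3
  simpa using h4

/-- `|z + c| < c` means `|z|² + 2c Re z < 0`, which holds for large `c` when `Re z < 0`. A spectrum
in the left half-plane is thus moved into a disc about the origin. -/
theorem exists_shift_norm_lt {S : Set ℂ} (hS : S.Finite) (h : ∀ z ∈ S, z.re < 0) (c₀ : ℝ) :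
    ∃ c : ℝ, 0 < c ∧ c₀ ≤ c ∧ ∀ z ∈ S, ‖z + c‖ < c := by
  have key : ∀ z ∈ S, ∀ᶠ c : ℝ in atTop, ‖z + c‖ < c := by
    intro z hz
    filter_upwards [eventually_gt_atTop 0, eventually_gt_atTop (‖z‖ ^ 2 / (-2 * z.re))]
      with c hc0 hc
    have hz' := h z hz
    rw [div_lt_iff₀ (by linarith)] at hc
    refine lt_of_pow_lt_pow_left₀ 2 hc0.le ?_
    rw [← Complex.normSq_eq_norm_sq] at hc ⊢
    simp only [Complex.normSq_apply, Complex.add_re, Complex.add_im, Complex.ofReal_re,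
      Complex.ofReal_im] at hc ⊢
    nlinarith
  have := (eventually_all_finite hS).2 key
  obtain ⟨c, h1, h2, h3⟩ := (this.and ((eventually_gt_atTop 0).and (eventually_ge_atTop c₀))).exists
  exact ⟨c, h2, h3, h1⟩

/-- For large `c` the matrix `N = c⁻¹ (A + (c - lam))` is entrywise nonnegative with spectral radius
below one. The Neumann series `ζ = ∑ N^k 1` is then at least `1` and satisfies `N ζ = ζ - 1`, that
is `A ζ = lam ζ - c 1`. No Perron eigenvector is needed. -/
theorem exists_pos_mulVec_le {m : ℕ} (A : Matrix (Fin m) (Fin m) ℝ)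
    (hA : ∀ i j, i ≠ j → 0 ≤ A i j) (lam : ℝ)
    (hlam : ∀ z ∈ spectrum ℂ (A.map (fun a : ℝ => (a : ℂ))), z.re < lam) :
    ∃ ζ : Fin m → ℝ, (∀ i, 0 < ζ i) ∧ ∀ i, (A *ᵥ ζ) i ≤ lam * ζ i := by
  rcases isEmpty_or_nonempty (Fin m) with hm | hm
  · exact ⟨fun _ => 1, fun i => (hm.false i).elim, fun i => (hm.false i).elim⟩
  set AC : Matrix (Fin m) (Fin m) ℂ := A.map (fun a : ℝ => (a : ℂ)) with hAC
  have hfin : (spectrum ℂ AC).Finite := Matrix.finite_spectrum AC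
  obtain ⟨c, hc0, hc, hspec⟩ := exists_shift_norm_lt
    (S := (fun z => z - (lam : ℂ)) '' spectrum ℂ AC) (hfin.image _)
    (by rintro _ ⟨z, hz, rfl⟩; simpa using hlam z hz) (∑ i, |A i i - lam|)
  set N : Matrix (Fin m) (Fin m) ℝ := c⁻¹ • (A + (c - lam) • 1) with hN
  set NC : Matrix (Fin m) (Fin m) ℂ := N.map (fun a : ℝ => (a : ℂ)) with hNC
  have hN0 : ∀ i j, 0 ≤ N i j := by
    intro i j
    have hi : |A i i - lam| ≤ c :=
      (Finset.single_le_sum (f := fun i => |A i i - lam|) (fun _ _ => abs_nonneg _)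
        (Finset.mem_univ i)).trans hc
    simp only [hN, Matrix.smul_apply, Matrix.add_apply, smul_eq_mul]
    refine mul_nonneg (inv_nonneg.2 hc0.le) ?_
    by_cases hij : i = j
    · subst hij
      have := neg_abs_le (A i i - lam)
      simp; linarith
    · simp [Matrix.one_apply_ne hij, hA i j hij]
  have hcC : (c : ℂ) ≠ 0 := by exact_mod_cast hc0.ne'
  have hNCeq : NC = (c : ℂ)⁻¹ • (AC + algebraMap ℂ _ ((c : ℂ) - lam)) := by
    ext i j
    by_cases hij : i = j
    · subst hij; simp [hNC, hN, hAC, Matrix.algebraMap_matrix_apply, mul_add]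
    · simp [hNC, hN, hAC, Matrix.algebraMap_matrix_apply, Matrix.one_apply_ne hij, hij]
  have hrad : spectralRadius ℂ NC < 1 := by
    have : ∀ k ∈ spectrum ℂ NC, ‖k‖₊ < 1 := by
      intro k hk
      have h1 : (c : ℂ) * k - (c - lam) ∈ spectrum ℂ AC := by
        have h2 : (Units.mk0 (c : ℂ) hcC) • k ∈ spectrum ℂ ((Units.mk0 (c : ℂ) hcC) • NC) :=
          spectrum.smul_mem_smul_iff.2 hk
        have h3 : (Units.mk0 (c : ℂ) hcC) • NC = AC + algebraMap ℂ _ ((c : ℂ) - lam) := by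
          rw [hNCeq, Units.smul_def, Units.val_mk0, smul_smul, mul_inv_cancel₀ hcC, one_smul]
        have h4 : (Units.mk0 (c : ℂ) hcC) • k = (c * k - (c - lam)) + ((c : ℂ) - lam) := by
          rw [Units.smul_def, Units.val_mk0, smul_eq_mul]; ring
        rwa [h3, add_comm AC, h4, spectrum.add_mem_add_iff] at h2
      have h2 := hspec _ ⟨_, h1, rfl⟩
      have h3 : (c : ℂ) * k - (c - lam) - lam + c = c * k := by ring
      simp only [h3, norm_mul, Complex.norm_real, Real.norm_eq_abs, abs_of_pos hc0] at h2
      have : ‖k‖ < 1 := by nlinarith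
      exact_mod_cast this
    exact_mod_cast spectrum.spectralRadius_lt_of_forall_lt NC this
  have hsum : Summable fun k : ℕ => ‖NC ^ k‖ := summable_norm_pow_of_spectralRadius_lt_one NC hrad
  have hmap : ∀ k : ℕ, NC ^ k = (N ^ k).map (fun a : ℝ => (a : ℂ)) := fun k =>
    (map_pow (Complex.ofRealHom.mapMatrix) N k).symm
  have hentry : ∀ i j, Summable fun k : ℕ => (N ^ k) i j := by
    intro i j
    refine Summable.of_norm_bounded hsum fun k => ?_
    have h1 : ‖(NC ^ k) i j‖ ≤ ‖NC ^ k‖ := by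
      have h2 : ‖(NC ^ k) i j‖₊ ≤ ‖NC ^ k‖₊ := by
        rw [Matrix.linfty_opNNNorm_def]
        exact (Finset.single_le_sum (f := fun j => ‖(NC ^ k) i j‖₊) (fun _ _ => zero_le)
          (Finset.mem_univ j)).trans
          (Finset.le_sup (f := fun i => ∑ j, ‖(NC ^ k) i j‖₊) (Finset.mem_univ i))
      exact_mod_cast h2
    simpa [hmap k] using h1
  have hpow0 : ∀ k : ℕ, ∀ i j, 0 ≤ (N ^ k) i j := by
    intro k
    induction k with
    | zero => intro i j; by_cases hij : i = j <;> simp [hij]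
    | succ k ih =>
      intro i j
      rw [pow_succ, Matrix.mul_apply]
      exact Finset.sum_nonneg fun l _ => mul_nonneg (ih _ _) (hN0 _ _)
  set w : ℕ → Fin m → ℝ := fun k i => ∑ j, (N ^ k) i j with hw
  have hws : ∀ i, Summable fun k => w k i := fun i => summable_sum fun j _ => hentry i j
  have hw0 : ∀ k i, 0 ≤ w k i := fun k i => Finset.sum_nonneg fun j _ => hpow0 k i j
  have hwsucc : ∀ k i, w (k + 1) i = ∑ j, N i j * w k j := by
    intro k i
    simp only [hw, pow_succ', Matrix.mul_apply, Finset.mul_sum]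
    rw [Finset.sum_comm]
  have hwz : ∀ i, w 0 i = 1 := by intro i; simp [hw, Matrix.one_apply]
  refine ⟨fun i => ∑' k, w k i, fun i => ?_, fun i => ?_⟩
  · have : w 0 i ≤ ∑' k, w k i := (hws i).le_tsum 0 fun k _ => hw0 k i
    rw [hwz] at this; linarith
  -- Applying `N` shifts the series by one index and loses the term `w 0 = 1`.
  · have h1 : ∑ j, N i j * ∑' k, w k j = ∑' k, w k i - 1 := by
      rw [(hws i).tsum_eq_zero_add, hwz]
      simp only [hwsucc, ← tsum_mul_left]
      rw [Summable.tsum_finsetSum fun j _ => (hws j).mul_left _]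
      ring
    have h2 : ∀ v : Fin m → ℝ, (A *ᵥ v) i = c * ∑ j, N i j * v j - (c - lam) * v i := by
      intro v
      have h3 : c • N = A + (c - lam) • 1 := by
        rw [hN, smul_smul, mul_inv_cancel₀ hc0.ne', one_smul]
      have h4 : (c • N) *ᵥ v = A *ᵥ v + (c - lam) • v := by
        rw [h3, Matrix.add_mulVec, Matrix.smul_mulVec, Matrix.one_mulVec]
      have h5 := congrFun h4 i
      simp only [Matrix.smul_mulVec, Pi.add_apply, Pi.smul_apply, smul_eq_mul] at h5
      have h6 : (N *ᵥ v) i = ∑ j, N i j * v j := rfl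
      rw [← h6]; linarith
    rw [h2, h1]
    linarith

/-- One step of the chain, weighted by a positive vector `ζ` with
`(Γ + diag u) ζ ≤ lam ζ`, contracts at rate close to `lam`. -/
theorem exists_forall_mul_exp_mulVec_le {m : ℕ} (Γ : Matrix (Fin m) (Fin m) ℝ) (u ζ : Fin m → ℝ)
    (hζ : ∀ i, 0 < ζ i) {lam lam' : ℝ} (hlam : lam < lam')
    (h : ∀ i, ((Γ + Matrix.diagonal u) *ᵥ ζ) i ≤ lam * ζ i) (C κ : ℝ) (hκ : 1 < κ) :
    ∃ δ > 0, ∀ Δ : ℝ, 0 < Δ → Δ < δ → ∀ i,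
      (1 + u i * Δ + C * Δ ^ κ) * (NormedSpace.exp (Δ • Γ) *ᵥ ζ) i
        ≤ ζ i * Real.exp (lam' * Δ) := by
  -- Both sides equal `ζ i` at `Δ = 0`, and the derivatives there are `u_i ζ_i + (Γ ζ)_i ≤ lam ζ_i <
  -- lam' ζ_i`. The term `C Δ^κ` has derivative zero because `κ > 1`.
  have key : ∀ i, ∀ᶠ Δ in 𝓝[>] (0 : ℝ),
      (1 + u i * Δ + C * Δ ^ κ) * (NormedSpace.exp (Δ • Γ) *ᵥ ζ) i
        ≤ ζ i * Real.exp (lam' * Δ) := by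
    intro i
    have h1 : HasDerivAt (fun Δ : ℝ => NormedSpace.exp (Δ • Γ)) Γ 0 := by
      have := hasDerivAt_exp_smul_const (𝕂 := ℝ) Γ (0 : ℝ)
      rw [zero_smul, NormedSpace.exp_zero, one_mul] at this
      exact this
    have h2 : HasDerivAt (fun Δ : ℝ => (NormedSpace.exp (Δ • Γ) *ᵥ ζ) i) ((Γ *ᵥ ζ) i) 0 := by
      have h3 : ∀ j, HasDerivAt (fun Δ : ℝ => NormedSpace.exp (Δ • Γ) i j) (Γ i j) 0 := by
        intro j
        let Lj : Matrix (Fin m) (Fin m) ℝ →ₗ[ℝ] ℝ :=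
          { toFun := fun M => M i j, map_add' := fun _ _ => rfl, map_smul' := fun _ _ => rfl }
        exact (LinearMap.toContinuousLinearMap Lj).hasFDerivAt.comp_hasDerivAt (0 : ℝ) h1
      exact HasDerivAt.fun_sum (u := Finset.univ) fun j _ => (h3 j).mul_const (ζ j)
    have h4 : HasDerivAt (fun Δ : ℝ => 1 + u i * Δ + C * Δ ^ κ) (u i) 0 := by
      have h5 : HasDerivAt (fun Δ : ℝ => Δ ^ κ) 0 0 := by
        have := Real.hasDerivAt_rpow_const (x := 0) (p := κ) (Or.inr hκ.le)
        rwa [Real.zero_rpow (by linarith), mul_zero] at this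
      have := (((hasDerivAt_id (0 : ℝ)).const_mul (u i)).const_add 1).add (h5.const_mul C)
      simpa using! this
    have h5 := h4.mul h2
    have h6 : HasDerivAt (fun Δ : ℝ => ζ i * Real.exp (lam' * Δ)) (ζ i * lam') 0 := by
      have := (((hasDerivAt_id (0 : ℝ)).const_mul lam').exp).const_mul (ζ i)
      simpa using! this
    have h7 := h6.sub h5
    have hpos : 0 < ζ i * lam' - (u i * (NormedSpace.exp ((0 : ℝ) • Γ) *ᵥ ζ) i +
        (1 + u i * 0 + C * (0 : ℝ) ^ κ) * (Γ *ᵥ ζ) i) := by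
      have h8 := h i
      have h9 : ζ i * lam < ζ i * lam' := mul_lt_mul_of_pos_left hlam (hζ i)
      rw [Matrix.add_mulVec, Pi.add_apply, Matrix.mulVec_diagonal] at h8
      simp [Real.zero_rpow (show κ ≠ 0 by linarith)]
      linarith
    have h8 := (hasDerivAt_iff_tendsto_slope.1 h7).eventually (lt_mem_nhds hpos)
    have h9 := h8.filter_mono (nhdsWithin_mono 0 (fun x (hx : 0 < x) => hx.ne'))
    filter_upwards [h9, self_mem_nhdsWithin] with Δ hΔ hΔ0
    have hΔ0' : (0 : ℝ) < Δ := hΔ0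
    rw [slope_def_field] at hΔ
    have h10 := (div_pos_iff_of_pos_right (by simpa using hΔ0')).1 hΔ
    simp [Real.zero_rpow (show κ ≠ 0 by linarith)] at h10
    linarith
  obtain ⟨δ, hδ, h2⟩ := mem_nhdsGT_iff_exists_Ioo_subset.1 (eventually_all.2 key)
  exact ⟨δ, hδ, fun Δ h0 h1 i => h2 ⟨h0, h1⟩ i⟩

end Metzler

/-! ### Global fourth-order bounds for `(1 + ξ)^s`. -/

theorem exists_one_add_rpow_le {s : ℝ} (hs : 0 < s) :
    ∃ c C : ℝ, 0 ≤ C ∧ ∃ M : ℕ, ∀ ξ : ℝ, -1 ≤ ξ →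
      (1 + ξ) ^ s ≤ 1 + s * ξ + s * (s - 1) / 2 * ξ ^ 2 + c * ξ ^ 3
        + C * ξ ^ 4 * (1 + |ξ|) ^ M := by
  set c : ℝ := Ring.choose s 3 with hc
  set T : ℝ → ℝ := fun ξ => 1 + s * ξ + s * (s - 1) / 2 * ξ ^ 2 + c * ξ ^ 3 with hT
  have h1 := (Real.one_add_rpow_hasFPowerSeriesAt_zero (a := s)).isBigO_sub_partialSum_pow 4
  have hsum : ∀ y : ℝ, (binomialSeries ℝ s).partialSum 4 y = T y := by
    intro y
    simp [FormalMultilinearSeries.partialSum, Finset.sum_range_succ, binomialSeries, hT, hc]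
    have h2 : Ring.choose s 2 = s * (s - 1) / 2 := by
      rw [Ring.choose_eq_smul, descPochhammer_succ_right, descPochhammer_one]
      simp [Polynomial.smeval_mul, Polynomial.smeval_sub, Nat.factorial]; ring
    rw [h2]; ring
  obtain ⟨C₁, hC₁0, hC₁⟩ := h1.exists_pos
  rw [Asymptotics.IsBigOWith] at hC₁
  obtain ⟨δ, hδ, hball⟩ := Metric.eventually_nhds_iff.1 hC₁
  obtain ⟨M₀, hM₀⟩ := exists_nat_ge s
  set M := M₀ + 3 with hM
  set B : ℝ := 2 + s + |s * (s - 1) / 2| + |c| with hB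
  have hB0 : 0 ≤ B := by positivity
  refine ⟨c, C₁ + B / δ ^ 4, by positivity, M, fun ξ hξ => ?_⟩
  have hone : (1 : ℝ) ≤ 1 + |ξ| := by linarith [abs_nonneg ξ]
  have hpow1 : (1 : ℝ) ≤ (1 + |ξ|) ^ M := one_le_pow₀ hone
  have hξ4 : 0 ≤ ξ ^ 4 := by positivity
  -- Near `0` the bound is Taylor's formula. For `|ξ| ≥ δ` everything grows at most like `(1 +
  -- |ξ|)^M`, and the factor `ξ⁴ / δ⁴ ≥ 1` absorbs it.
  rcases lt_or_ge |ξ| δ with hlt | hge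
  · have h2 := hball (y := ξ) (by simpa [Real.dist_eq] using hlt)
    rw [zero_add, hsum] at h2
    have h3 := (le_abs_self _).trans h2
    have h4 : ‖‖ξ‖ ^ 4‖ = ξ ^ 4 := by
      rw [norm_pow, norm_norm, Real.norm_eq_abs, Even.pow_abs (by decide)]
    rw [h4] at h3
    have h5 : C₁ * ξ ^ 4 ≤ (C₁ + B / δ ^ 4) * ξ ^ 4 * (1 + |ξ|) ^ M := by
      calc C₁ * ξ ^ 4 ≤ (C₁ + B / δ ^ 4) * ξ ^ 4 * 1 := by
            rw [mul_one]; gcongr; linarith [show 0 ≤ B / δ ^ 4 by positivity]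
        _ ≤ _ := by gcongr
    simp only [hT] at h3
    linarith
  · have h2 : (1 + ξ) ^ s ≤ (1 + |ξ|) ^ M := by
      calc (1 + ξ) ^ s ≤ (1 + |ξ|) ^ s :=
            Real.rpow_le_rpow (by linarith) (by linarith [le_abs_self ξ]) hs.le
        _ ≤ (1 + |ξ|) ^ (M : ℝ) := Real.rpow_le_rpow_of_exponent_le hone (by
            rw [hM]; push_cast; linarith)
        _ = _ := Real.rpow_natCast _ _
    have hk : ∀ k ≤ 3, |ξ| ^ k ≤ (1 + |ξ|) ^ M := fun k hk =>
      (pow_le_pow_left₀ (abs_nonneg _) (by linarith) k).trans (pow_le_pow_right₀ hone (by omega))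
    have h3 : -(1 + s * ξ + s * (s - 1) / 2 * ξ ^ 2 + c * ξ ^ 3)
        ≤ (1 + s + |s * (s - 1) / 2| + |c|) * (1 + |ξ|) ^ M := by
      have e1 : -(s * ξ) ≤ s * (1 + |ξ|) ^ M := by
        have := hk 1 (by norm_num)
        rw [pow_one] at this
        nlinarith [neg_abs_le ξ]
      have e2 : -(s * (s - 1) / 2 * ξ ^ 2) ≤ |s * (s - 1) / 2| * (1 + |ξ|) ^ M := by
        refine (neg_le_abs _).trans ?_
        rw [abs_mul, abs_pow]
        exact mul_le_mul_of_nonneg_left (hk 2 (by norm_num)) (abs_nonneg _)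
      have e3 : -(c * ξ ^ 3) ≤ |c| * (1 + |ξ|) ^ M := by
        refine (neg_le_abs _).trans ?_
        rw [abs_mul, abs_pow]
        exact mul_le_mul_of_nonneg_left (hk 3 (by norm_num)) (abs_nonneg _)
      nlinarith
    have h4 : δ ^ 4 ≤ ξ ^ 4 := by
      rw [← Even.pow_abs (by decide : Even 4) ξ]; exact pow_le_pow_left₀ hδ.le hge 4
    have h5 : B * (1 + |ξ|) ^ M ≤ (C₁ + B / δ ^ 4) * ξ ^ 4 * (1 + |ξ|) ^ M := by
      gcongr
      calc B = B / δ ^ 4 * δ ^ 4 := by field_simp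
        _ ≤ (C₁ + B / δ ^ 4) * ξ ^ 4 := by gcongr; linarith
    rw [hB] at h5
    linarith

/-- Here `A` has order `ε` and `v` only order `√ε`. In the sum over `±v` the terms `v`, `A v`, `v³`
and `A² v` cancel. What remains beyond the displayed terms is made of `A²`, `A³`, `A v²` and fourth
powers, all of order `ε²`. The variable `L` carries the dependence on the noise and may be
unbounded, so it is kept as a power. -/
theorem exists_symm_one_add_rpow_le {s : ℝ} (hs : 0 < s) :
    ∃ C : ℝ, 0 ≤ C ∧ ∃ M : ℕ, ∀ ε L A v : ℝ, 0 ≤ ε → ε ≤ 1 → 1 ≤ L → |A| ≤ ε * L → v ^ 2 ≤ ε * L →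
      -1 ≤ A + v → -1 ≤ A - v →
      (1 + A + v) ^ s + (1 + A - v) ^ s
        ≤ 2 * (1 + s * A + s * (s - 1) / 2 * v ^ 2) + C * ε ^ 2 * L ^ M := by
  obtain ⟨c, C, hC, M, h⟩ := exists_one_add_rpow_le hs
  refine ⟨|s * (s - 1)| + 8 * |c| + 32 * C * 3 ^ M, by positivity, M + 4,
    fun ε L A v hε hε1 hL hA hv h1 h2 => ?_⟩
  have hL0 : 0 ≤ L := by linarith
  have hA2 : A ^ 2 ≤ ε ^ 2 * L ^ 2 := by
    rw [← mul_pow, ← sq_abs]; exact pow_le_pow_left₀ (abs_nonneg _) hA 2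
  have hε2 : 0 ≤ ε ^ 2 := by positivity
  have hL4 : (1 : ℝ) ≤ L ^ M := one_le_pow₀ hL
  have hεL : ε * L ≤ L := by nlinarith
  have hA1 : |A| ≤ L := hA.trans hεL
  have hv1 : |v| ≤ L := abs_le.2 (abs_le_of_sq_le_sq' (by nlinarith) hL0)
  have hA3 : |A ^ 3| ≤ ε ^ 2 * L ^ 3 := by
    rw [pow_succ, abs_mul, abs_of_nonneg (sq_nonneg A)]
    calc A ^ 2 * |A| ≤ (ε ^ 2 * L ^ 2) * L := by gcongr
      _ = _ := by ring
  have hAv : |A * v ^ 2| ≤ ε ^ 2 * L ^ 2 := by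
    rw [abs_mul, abs_of_nonneg (sq_nonneg v)]
    calc |A| * v ^ 2 ≤ (ε * L) * (ε * L) := by gcongr
      _ = _ := by ring
  have hv4 : v ^ 4 ≤ ε ^ 2 * L ^ 2 := by
    calc v ^ 4 = v ^ 2 * v ^ 2 := by ring
      _ ≤ (ε * L) * (ε * L) := by gcongr
      _ = _ := by ring
  have hA4 : A ^ 4 ≤ ε ^ 2 * L ^ 4 := by
    calc A ^ 4 = A ^ 2 * |A| ^ 2 := by rw [sq_abs]; ring
      _ ≤ (ε ^ 2 * L ^ 2) * L ^ 2 := by gcongr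
      _ = _ := by ring
  have hquart : ∀ ξ : ℝ, ξ ^ 4 ≤ 8 * (A ^ 4 + v ^ 4) → |ξ| ≤ 2 * L →
      C * ξ ^ 4 * (1 + |ξ|) ^ M ≤ 16 * C * 3 ^ M * (ε ^ 2 * L ^ (M + 4)) := by
    intro ξ h3 h4
    have h5 : ξ ^ 4 ≤ 16 * (ε ^ 2 * L ^ 4) := by
      have : ε ^ 2 * L ^ 2 ≤ ε ^ 2 * L ^ 4 := by gcongr; norm_num
      linarith
    calc C * ξ ^ 4 * (1 + |ξ|) ^ M ≤ C * (16 * (ε ^ 2 * L ^ 4)) * (3 * L) ^ M := by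
          gcongr; linarith
      _ = _ := by rw [mul_pow]; ring
  have q1 := hquart (A + v)
    (by nlinarith [sq_nonneg (A - v), sq_nonneg (A ^ 2 - v ^ 2), sq_nonneg ((A - v) ^ 2),
      sq_nonneg (A * v)])
    ((abs_add_le _ _).trans (by linarith))
  have q2 := hquart (A - v)
    (by nlinarith [sq_nonneg (A + v), sq_nonneg (A ^ 2 - v ^ 2)]) ((abs_sub _ _).trans (by linarith))
  have t1 := h (A + v) h1
  have t2 := h (A - v) h2
  have e1 : s * (s - 1) * A ^ 2 ≤ |s * (s - 1)| * (ε ^ 2 * L ^ (M + 4)) := by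
    refine (mul_le_mul_of_nonneg_right (le_abs_self _) (sq_nonneg A)).trans ?_
    gcongr
    exact hA2.trans (by gcongr; omega)
  have e2 : c * (2 * A ^ 3 + 6 * (A * v ^ 2)) ≤ 8 * |c| * (ε ^ 2 * L ^ (M + 4)) := by
    refine (le_abs_self _).trans ?_
    rw [abs_mul]
    have i1 : ε ^ 2 * L ^ 3 ≤ ε ^ 2 * L ^ (M + 4) := by gcongr; omega
    have i2 : ε ^ 2 * L ^ 2 ≤ ε ^ 2 * L ^ (M + 4) := by gcongr; omega
    have : |2 * A ^ 3 + 6 * (A * v ^ 2)| ≤ 8 * (ε ^ 2 * L ^ (M + 4)) := by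
      refine (abs_add_le _ _).trans ?_
      rw [abs_mul, abs_mul 6, abs_two, abs_of_pos (by norm_num : (0 : ℝ) < 6)]
      linarith
    calc |c| * |2 * A ^ 3 + 6 * (A * v ^ 2)| ≤ |c| * (8 * (ε ^ 2 * L ^ (M + 4))) := by gcongr
      _ = _ := by ring
  rw [← add_assoc] at t1
  rw [← add_sub_assoc] at t2
  nlinarith

/-! ### Algebra and norm bounds for the form `Q`. -/

/-- The bilinear form `xᵀ Q y`. -/
def bform {n : ℕ} (Q : Matrix (Fin n) (Fin n) ℝ) (x y : EuclideanSpace ℝ (Fin n)) : ℝ :=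
  x.ofLp ⬝ᵥ (Q *ᵥ y.ofLp)

/-- The action of a matrix on Euclidean vectors. -/
def act {n d : ℕ} (G : Matrix (Fin n) (Fin d) ℝ) (b : EuclideanSpace ℝ (Fin d)) :
    EuclideanSpace ℝ (Fin n) := WithLp.toLp 2 (G *ᵥ b.ofLp)

/-- The row vector `xᵀ Q G`. -/
def row {n d : ℕ} (Q : Matrix (Fin n) (Fin n) ℝ) (G : Matrix (Fin n) (Fin d) ℝ)
    (x : EuclideanSpace ℝ (Fin n)) : EuclideanSpace ℝ (Fin d) :=
  WithLp.toLp 2 (x.ofLp ᵥ* (Q * G))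

section Algebra

variable {n d : ℕ} (Q : Matrix (Fin n) (Fin n) ℝ) (G : Matrix (Fin n) (Fin d) ℝ)

theorem bform_add_left (x y z : EuclideanSpace ℝ (Fin n)) :
    bform Q (x + y) z = bform Q x z + bform Q y z := by
  simp [bform, add_dotProduct]

theorem bform_add_right (x y z : EuclideanSpace ℝ (Fin n)) :
    bform Q x (y + z) = bform Q x y + bform Q x z := by
  simp [bform, Matrix.mulVec_add, dotProduct_add]

theorem bform_smul_left (c : ℝ) (x y : EuclideanSpace ℝ (Fin n)) :
    bform Q (c • x) y = c * bform Q x y := by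
  simp [bform]

theorem bform_smul_right (c : ℝ) (x y : EuclideanSpace ℝ (Fin n)) :
    bform Q x (c • y) = c * bform Q x y := by
  simp [bform, Matrix.mulVec_smul]

theorem bform_self (x : EuclideanSpace ℝ (Fin n)) : bform Q x x = quad Q x := rfl

variable {Q} in
theorem bform_comm (hQ : Q.IsSymm) (x y : EuclideanSpace ℝ (Fin n)) :
    bform Q x y = bform Q y x := by
  rw [bform, bform, dotProduct_comm, ← Matrix.vecMul_transpose, hQ.eq, Matrix.dotProduct_mulVec]

variable {Q} in
theorem quad_add (hQ : Q.IsSymm) (x y : EuclideanSpace ℝ (Fin n)) :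
    quad Q (x + y) = quad Q x + 2 * bform Q x y + quad Q y := by
  rw [← bform_self, bform_add_left, bform_add_right, bform_add_right, bform_comm hQ y x,
    bform_self, bform_self]
  ring

theorem quad_smul (c : ℝ) (x : EuclideanSpace ℝ (Fin n)) : quad Q (c • x) = c ^ 2 * quad Q x := by
  rw [← bform_self, bform_smul_left, bform_smul_right, bform_self]; ring

theorem act_smul (c : ℝ) (b : EuclideanSpace ℝ (Fin d)) : act G (c • b) = c • act G b := by
  ext; simp [act, Matrix.mulVec_smul]

theorem row_add (x y : EuclideanSpace ℝ (Fin n)) : row Q G (x + y) = row Q G x + row Q G y := by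
  ext; simp [row, Matrix.add_vecMul]

theorem bform_act (x : EuclideanSpace ℝ (Fin n)) (b : EuclideanSpace ℝ (Fin d)) :
    bform Q x (act G b) = inner ℝ (row Q G x) b := by
  simp only [bform, act, row, PiLp.inner_apply, RCLike.inner_apply, conj_trivial]
  rw [Matrix.mulVec_mulVec, Matrix.dotProduct_mulVec, dotProduct]
  exact Finset.sum_congr rfl fun i _ => mul_comm _ _

theorem quad_act (b : EuclideanSpace ℝ (Fin d)) :
    quad Q (act G b) = ∑ a, ∑ a', (Gᵀ * Q * G) a a' * (b a * b a') := by
  have : quad Q (act G b) = b.ofLp ⬝ᵥ ((Gᵀ * Q * G) *ᵥ b.ofLp) := by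
    simp only [quad, act]
    rw [← Matrix.mulVec_mulVec, ← Matrix.mulVec_mulVec, Matrix.dotProduct_mulVec b.ofLp,
      Matrix.vecMul_transpose]
  rw [this]
  simp only [dotProduct, Matrix.mulVec, Finset.mul_sum]
  exact Finset.sum_congr rfl fun a _ => Finset.sum_congr rfl fun a' _ => by ring

theorem traceNorm_nonneg : 0 ≤ traceNorm G := Real.sqrt_nonneg _

theorem traceNorm_sq : traceNorm G ^ 2 = ∑ i, ∑ a, G i a ^ 2 := by
  have : (Gᵀ * G).trace = ∑ i, ∑ a, G i a ^ 2 := by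
    simp only [Matrix.trace, Matrix.diag, Matrix.mul_apply, Matrix.transpose_apply]
    rw [Finset.sum_comm]
    exact Finset.sum_congr rfl fun i _ => Finset.sum_congr rfl fun a _ => by ring
  rw [traceNorm, this, Real.sq_sqrt]
  positivity

theorem norm_act_le (b : EuclideanSpace ℝ (Fin d)) : ‖act G b‖ ≤ traceNorm G * ‖b‖ := by
  refine (abs_le_of_sq_le_sq' ?_ (mul_nonneg (traceNorm_nonneg G) (norm_nonneg _))).2
  rw [mul_pow, traceNorm_sq, EuclideanSpace.real_norm_sq_eq, EuclideanSpace.real_norm_sq_eq,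
    Finset.sum_mul]
  exact Finset.sum_le_sum fun i _ =>
    Finset.sum_mul_sq_le_sq_mul_sq Finset.univ (fun a => G i a) fun a => b a

theorem exists_bform_le : ∃ C : ℝ, 0 < C ∧ ∀ x y, |bform Q x y| ≤ C * ‖x‖ * ‖y‖ := by
  refine ⟨traceNorm Q + 1, by linarith [traceNorm_nonneg Q], fun x y => ?_⟩
  have h1 : bform Q x y = inner ℝ x (act Q y) := by
    simp only [bform, act, PiLp.inner_apply, RCLike.inner_apply, conj_trivial, dotProduct]
    exact Finset.sum_congr rfl fun i _ => mul_comm _ _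
  rw [h1]
  calc |inner ℝ x (act Q y)| ≤ ‖x‖ * ‖act Q y‖ := abs_real_inner_le_norm _ _
    _ ≤ ‖x‖ * ((traceNorm Q + 1) * ‖y‖) := by
      gcongr
      refine (norm_act_le Q y).trans ?_
      gcongr; linarith
    _ = _ := by ring

theorem continuous_quad : Continuous (quad Q) := by
  unfold quad
  simp only [dotProduct]
  fun_prop

theorem continuous_act : Continuous (act G) := by
  unfold act
  simp only [Matrix.mulVec]
  fun_prop

variable {Q} in
theorem quad_pos (hQ : Q.PosDef) {x : EuclideanSpace ℝ (Fin n)} (hx : x ≠ 0) : 0 < quad Q x := by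
  have : x.ofLp ≠ 0 := by simpa using hx
  simpa [quad] using hQ.dotProduct_mulVec_pos this

variable {Q} in
theorem quad_nonneg (hQ : Q.PosDef) (x : EuclideanSpace ℝ (Fin n)) : 0 ≤ quad Q x := by
  simpa [quad] using hQ.posSemidef.dotProduct_mulVec_nonneg x.ofLp

variable {Q} in
theorem exists_le_quad (hQ : Q.PosDef) : ∃ c : ℝ, 0 < c ∧ ∀ x, c * ‖x‖ ^ 2 ≤ quad Q x := by
  -- The unit sphere is empty in dimension zero; otherwise compactness gives a positive minimum of
  -- the form on it.
  rcases (Metric.sphere (0 : EuclideanSpace ℝ (Fin n)) 1).eq_empty_or_nonempty with he | hne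
  · refine ⟨1, one_pos, fun x => ?_⟩
    by_cases hx : x = 0
    · simp [hx, quad]
    · have : ‖x‖⁻¹ • x ∈ Metric.sphere (0 : EuclideanSpace ℝ (Fin n)) 1 := by
        simp [norm_smul, hx]
      simp [he] at this
  · obtain ⟨u, hu, hmin⟩ := (isCompact_sphere (0 : EuclideanSpace ℝ (Fin n)) 1).exists_isMinOn hne
      (continuous_quad Q).continuousOn
    have hu0 : u ≠ 0 := by rintro rfl; simp at hu
    refine ⟨quad Q u, quad_pos hQ hu0, fun x => ?_⟩
    by_cases hx : x = 0
    · simp [hx, quad]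
    · have h1 : ‖x‖⁻¹ • x ∈ Metric.sphere (0 : EuclideanSpace ℝ (Fin n)) 1 := by
        simp [norm_smul, hx]
      have h2 : quad Q u ≤ quad Q (‖x‖⁻¹ • x) := hmin h1
      rw [quad_smul, inv_pow] at h2
      have h3 : 0 < ‖x‖ ^ 2 := by positivity
      rwa [le_inv_mul_iff₀ h3, mul_comm] at h2

variable {Q G} in
-- Duality: `b ↦ xᵀ Q G b` is represented by `row Q G x`, so testing it against `b = row Q G x`
-- gives the squared norm.
theorem norm_row_le {C : ℝ} (hC : 0 ≤ C) (h : ∀ x y, |bform Q x y| ≤ C * ‖x‖ * ‖y‖)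
    (x : EuclideanSpace ℝ (Fin n)) : ‖row Q G x‖ ≤ C * ‖x‖ * traceNorm G := by
  have h1 := (le_abs_self _).trans (h x (act G (row Q G x)))
  rw [bform_act, real_inner_self_eq_norm_sq] at h1
  have h2 := norm_act_le G (row Q G x)
  have h3 : ‖row Q G x‖ ^ 2 ≤ (C * ‖x‖ * traceNorm G) * ‖row Q G x‖ :=
    h1.trans (by rw [mul_assoc _ (traceNorm G)]; gcongr)
  rcases (norm_nonneg (row Q G x)).eq_or_lt with h0 | h0
  · rw [← h0]; have := traceNorm_nonneg G; positivity
  · nlinarith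

end Algebra

/-! ### Moments and symmetry of the standard Gaussian measure. -/

section Gaussian

variable {d : ℕ}

theorem map_neg_stdGaussian :
    (stdGaussian (EuclideanSpace ℝ (Fin d))).map (fun b => -b)
      = stdGaussian (EuclideanSpace ℝ (Fin d)) :=
  stdGaussian_map (LinearIsometryEquiv.neg ℝ)

theorem integrable_norm_pow_stdGaussian (k : ℕ) :
    Integrable (fun b => ‖b‖ ^ k) (stdGaussian (EuclideanSpace ℝ (Fin d))) :=
  (IsGaussian.memLp_id (stdGaussian (EuclideanSpace ℝ (Fin d))) k (by simp)).integrable_norm_pow'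

theorem integrable_one_add_norm_pow_stdGaussian (K : ℝ) (k : ℕ) :
    Integrable (fun b => (1 + K * (1 + ‖b‖ ^ 2)) ^ k)
      (stdGaussian (EuclideanSpace ℝ (Fin d))) := by
  have : ∀ b : EuclideanSpace ℝ (Fin d), (1 + K * (1 + ‖b‖ ^ 2)) ^ k =
      ∑ j ∈ Finset.range (k + 1), ((1 + K) ^ (k - j) * k.choose j * K ^ j) * ‖b‖ ^ (2 * j) := by
    intro b
    rw [show 1 + K * (1 + ‖b‖ ^ 2) = K * ‖b‖ ^ 2 + (1 + K) by ring, add_pow]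
    refine Finset.sum_congr rfl fun j _ => ?_
    rw [mul_pow, ← pow_mul]; ring
  simp only [this]
  exact integrable_finsetSum _ fun j _ => (integrable_norm_pow_stdGaussian (2 * j)).const_mul _

theorem integral_inner_mul_inner_stdGaussian (u v : EuclideanSpace ℝ (Fin d)) :
    ∫ b, inner ℝ u b * inner ℝ v b ∂(stdGaussian (EuclideanSpace ℝ (Fin d))) = inner ℝ u v := by
  have h1 := covarianceBilin_apply (μ := stdGaussian (EuclideanSpace ℝ (Fin d)))
    IsGaussian.memLp_two_id u v
  rw [covarianceBilin_stdGaussian] at h1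
  rw [innerSL_apply_apply] at h1
  simpa using h1.symm

theorem integrable_inner_mul_inner_stdGaussian (u v : EuclideanSpace ℝ (Fin d)) :
    Integrable (fun b => inner ℝ u b * inner ℝ v b)
      (stdGaussian (EuclideanSpace ℝ (Fin d))) := by
  have h := fun w : EuclideanSpace ℝ (Fin d) =>
    IsGaussian.memLp_dual (stdGaussian (EuclideanSpace ℝ (Fin d))) (innerSL ℝ w) 2 (by simp)
  exact (h u).integrable_mul (h v)

theorem integral_quad_act {n : ℕ} (Q : Matrix (Fin n) (Fin n) ℝ) (G : Matrix (Fin n) (Fin d) ℝ) :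
    Integrable (fun b => quad Q (act G b)) (stdGaussian (EuclideanSpace ℝ (Fin d))) ∧
    ∫ b, quad Q (act G b) ∂(stdGaussian (EuclideanSpace ℝ (Fin d))) = (Gᵀ * Q * G).trace := by
  have hs : ∀ (a : Fin d) (b : EuclideanSpace ℝ (Fin d)),
      inner ℝ (EuclideanSpace.single a (1 : ℝ)) b = b a := fun a b => by
    rw [EuclideanSpace.inner_single_left]; simp
  have hi : ∀ a a' : Fin d, Integrable (fun b : EuclideanSpace ℝ (Fin d) => b a * b a')
      (stdGaussian (EuclideanSpace ℝ (Fin d))) := fun a a' => by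
    simpa only [hs] using integrable_inner_mul_inner_stdGaussian
      (EuclideanSpace.single a (1 : ℝ)) (EuclideanSpace.single a' (1 : ℝ))
  have hv : ∀ a a' : Fin d, ∫ b : EuclideanSpace ℝ (Fin d), b a * b a'
      ∂(stdGaussian (EuclideanSpace ℝ (Fin d))) = if a = a' then 1 else 0 := fun a a' => by
    have := integral_inner_mul_inner_stdGaussian (EuclideanSpace.single a (1 : ℝ))
      (EuclideanSpace.single a' (1 : ℝ))
    simp only [hs] at this
    rw [this]
    simp
  have key : ∀ M : Fin d → Fin d → ℝ,
      Integrable (fun b : EuclideanSpace ℝ (Fin d) => ∑ a, ∑ a', M a a' * (b a * b a'))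
        (stdGaussian (EuclideanSpace ℝ (Fin d))) ∧
      ∫ b : EuclideanSpace ℝ (Fin d), ∑ a, ∑ a', M a a' * (b a * b a')
        ∂(stdGaussian (EuclideanSpace ℝ (Fin d))) = ∑ a, M a a := by
    intro M
    have hi1 : ∀ a a', Integrable (fun b : EuclideanSpace ℝ (Fin d) => M a a' * (b a * b a'))
        (stdGaussian (EuclideanSpace ℝ (Fin d))) := fun a a' => (hi a a').const_mul _
    have hi2 := fun a => integrable_finsetSum Finset.univ fun a' _ => hi1 a a'
    refine ⟨integrable_finsetSum _ fun a _ => hi2 a, ?_⟩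
    rw [integral_finsetSum _ fun a _ => hi2 a]
    simp [integral_finsetSum _ fun a' _ => hi1 _ a', integral_const_mul, hv]
  simp only [quad_act]
  exact key fun a a' => (Gᵀ * Q * G) a a'

end Gaussian

/-- By invariance under `b ↦ -b`, only the symmetrised function has to be dominated pointwise. With
the lower integral, integrability of `φ` need not be known beforehand. -/
theorem lintegral_stdGaussian_le_of_symm {d : ℕ} {φ ψ : EuclideanSpace ℝ (Fin d) → ℝ}
    (hφ : Measurable φ) (hφ0 : ∀ b, 0 ≤ φ b)
    (hψ : Integrable ψ (stdGaussian (EuclideanSpace ℝ (Fin d))))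
    (h : ∀ b, φ b + φ (-b) ≤ 2 * ψ b) :
    ∫⁻ b, ENNReal.ofReal (φ b) ∂(stdGaussian (EuclideanSpace ℝ (Fin d))) ≤
      ENNReal.ofReal (∫ b, ψ b ∂(stdGaussian (EuclideanSpace ℝ (Fin d)))) := by
  set μ := stdGaussian (EuclideanSpace ℝ (Fin d)) with hμ
  have h1 : ∫⁻ b, ENNReal.ofReal (φ (-b)) ∂μ = ∫⁻ b, ENNReal.ofReal (φ b) ∂μ := by
    conv_rhs => rw [hμ, ← map_neg_stdGaussian]
    rw [lintegral_map (by fun_prop) (by fun_prop)]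
  have h2 : ∫⁻ b, ENNReal.ofReal (φ b) ∂μ + ∫⁻ b, ENNReal.ofReal (φ b) ∂μ
      ≤ 2 * ENNReal.ofReal (∫ b, ψ b ∂μ) := by
    nth_rewrite 2 [← h1]
    have hψ0 : ∀ b, 0 ≤ ψ b := fun b => by linarith [h b, hφ0 b, hφ0 (-b)]
    rw [← lintegral_add_left (by fun_prop), ofReal_integral_eq_lintegral_ofReal hψ
      (Eventually.of_forall hψ0), ← lintegral_const_mul' _ _ (by simp)]
    refine lintegral_mono fun b => ?_
    rw [← ENNReal.ofReal_add (hφ0 _) (hφ0 _)]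
    refine (ENNReal.ofReal_le_ofReal (h b)).trans_eq ?_
    rw [ENNReal.ofReal_mul zero_le_two]; simp
  rw [← two_mul] at h2
  exact (ENNReal.mul_le_mul_iff_right (by simp) (by simp)).1 h2

/-! ### The one-step moment estimate. -/

/-- The size conditions on one step of the scheme from `x`, with drift `F`, diffusion `G` and
stepsize `Δ`: both are at most of linear size with constant `H`, where `Δ H ≤ K ε`. The constants
`C` and `k` compare the form `Q` with the norm. -/
structure IsSmallStep {n d : ℕ} (Q : Matrix (Fin n) (Fin n) ℝ) (C k K ε Δ H : ℝ)
    (x F : EuclideanSpace ℝ (Fin n)) (G : Matrix (Fin n) (Fin d) ℝ) : Prop where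
  posDef : Q.PosDef
  C_nonneg : 0 ≤ C
  bform_le : ∀ x y, |bform Q x y| ≤ C * ‖x‖ * ‖y‖
  k_nonneg : 0 ≤ k
  K_nonneg : 0 ≤ K
  eps_nonneg : 0 ≤ ε
  eps_le_one : ε ≤ 1
  step_pos : 0 < Δ
  H_nonneg : 0 ≤ H
  step_mul_le : Δ * H ≤ K * ε
  quad_pos : 0 < quad Q x
  norm_sq_le : C * ‖x‖ ^ 2 ≤ k * quad Q x
  drift : ‖F‖ ≤ H * ‖x‖
  diffusion : traceNorm G ^ 2 ≤ H * ‖x‖ ^ 2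

namespace IsSmallStep

variable {n d : ℕ} {Q : Matrix (Fin n) (Fin n) ℝ} {C k K ε Δ H : ℝ}
  {x F : EuclideanSpace ℝ (Fin n)} {G : Matrix (Fin n) (Fin d) ℝ}

theorem isSymm (h : IsSmallStep Q C k K ε Δ H x F G) : Q.IsSymm := by
  simpa using h.posDef.isHermitian

theorem step_mul_nonneg (h : IsSmallStep Q C k K ε Δ H x F G) : 0 ≤ Δ * H :=
  mul_nonneg h.step_pos.le h.H_nonneg

theorem norm_smul_drift_le (h : IsSmallStep Q C k K ε Δ H x F G) :
    ‖Δ • F‖ ≤ Δ * H * ‖x‖ := by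
  rw [norm_smul, Real.norm_eq_abs, abs_of_pos h.step_pos, mul_assoc]
  exact mul_le_mul_of_nonneg_left h.drift h.step_pos.le

theorem norm_add_drift_le (h : IsSmallStep Q C k K ε Δ H x F G) :
    ‖x + Δ • F‖ ≤ (1 + K) * ‖x‖ := by
  have hΔHK : Δ * H ≤ K :=
    h.step_mul_le.trans (mul_le_of_le_one_right h.K_nonneg h.eps_le_one)
  have h1 : Δ * H * ‖x‖ ≤ K * ‖x‖ := mul_le_mul_of_nonneg_right hΔHK (norm_nonneg _)
  linarith [norm_add_le x (Δ • F), h.norm_smul_drift_le]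

theorem quad_add_drift (h : IsSmallStep Q C k K ε Δ H x F G) :
    quad Q (x + Δ • F) = quad Q x + 2 * Δ * bform Q x F + Δ ^ 2 * quad Q F := by
  rw [quad_add h.isSymm, bform_smul_right, quad_smul]; ring

theorem abs_bform_drift_le (h : IsSmallStep Q C k K ε Δ H x F G) :
    |2 * Δ * bform Q x F| ≤ k * (2 * K) * ε * quad Q x := by
  obtain ⟨-, hC, hb, hk, hK, hε0, hε1, hΔ, hH, hΔH, hq0, hNq, hF, hG⟩ := id h
  have h0 := h.step_mul_nonneg
  have h1 : |bform Q x (Δ • F)| ≤ C * ‖x‖ * (Δ * H * ‖x‖) :=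
    (hb _ _).trans (mul_le_mul_of_nonneg_left h.norm_smul_drift_le (by positivity))
  rw [bform_smul_right] at h1
  rw [mul_assoc, abs_mul, abs_two]
  calc 2 * |Δ * bform Q x F| ≤ 2 * ((C * ‖x‖ ^ 2) * (Δ * H)) := by linarith
    _ ≤ 2 * ((k * quad Q x) * (K * ε)) := by gcongr
    _ = _ := by ring

theorem quad_drift_le (h : IsSmallStep Q C k K ε Δ H x F G) :
    Δ ^ 2 * quad Q F ≤ k * K ^ 2 * ε ^ 2 * quad Q x := by
  obtain ⟨-, hC, hb, hk, hK, hε0, hε1, hΔ, hH, hΔH, hq0, hNq, hF, hG⟩ := id h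
  have h0 := h.step_mul_nonneg
  have h2 := h.norm_smul_drift_le
  have h1 : quad Q (Δ • F) ≤ C * (Δ * H * ‖x‖) * (Δ * H * ‖x‖) :=
    (le_abs_self _).trans ((hb _ _).trans (by gcongr))
  rw [quad_smul] at h1
  calc Δ ^ 2 * quad Q F ≤ (C * ‖x‖ ^ 2) * (Δ * H) ^ 2 := by linarith
    _ ≤ (k * quad Q x) * (K * ε) ^ 2 := by gcongr
    _ = _ := by ring

theorem norm_act_sq_le (h : IsSmallStep Q C k K ε Δ H x F G) (b : EuclideanSpace ℝ (Fin d)) :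
    ‖act G b‖ ^ 2 ≤ H * ‖x‖ ^ 2 * ‖b‖ ^ 2 := by
  calc ‖act G b‖ ^ 2 ≤ (traceNorm G * ‖b‖) ^ 2 :=
        pow_le_pow_left₀ (norm_nonneg _) (norm_act_le G b) 2
    _ = traceNorm G ^ 2 * ‖b‖ ^ 2 := by ring
    _ ≤ _ := mul_le_mul_of_nonneg_right h.diffusion (sq_nonneg _)

theorem abs_even_part_le (h : IsSmallStep Q C k K ε Δ H x F G) (b : EuclideanSpace ℝ (Fin d)) :
    |(2 * Δ * bform Q x F + Δ ^ 2 * quad Q F) / quad Q x + Δ / quad Q x * quad Q (act G b)|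
      ≤ ε * (k * (2 * K + K ^ 2) * (1 + ‖b‖ ^ 2)) := by
  obtain ⟨hQ, hC, hb, hk, hK, hε0, hε1, hΔ, hH, hΔH, hq0, hNq, hF, hG⟩ := id h
  have hFF0 := quad_nonneg hQ F
  have hGG0 := quad_nonneg hQ (act G b)
  have h0 := h.step_mul_nonneg
  have h1 : |(2 * Δ * bform Q x F + Δ ^ 2 * quad Q F) / quad Q x| ≤ k * (2 * K + K ^ 2) * ε := by
    rw [abs_div, abs_of_pos hq0, div_le_iff₀ hq0]
    refine (abs_add_le _ _).trans ?_
    rw [abs_of_nonneg (by positivity : 0 ≤ Δ ^ 2 * quad Q F)]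
    have h2 : ε ^ 2 ≤ ε := by nlinarith
    have : k * K ^ 2 * ε ^ 2 * quad Q x ≤ k * K ^ 2 * ε * quad Q x := by gcongr
    linarith [h.abs_bform_drift_le, h.quad_drift_le]
  have h2 : |Δ / quad Q x * quad Q (act G b)| ≤ k * K * ε * ‖b‖ ^ 2 := by
    rw [abs_of_nonneg (by positivity), div_mul_eq_mul_div, div_le_iff₀ hq0]
    have h3 : quad Q (act G b) ≤ C * ‖act G b‖ * ‖act G b‖ :=
      (le_abs_self _).trans (hb _ _)
    have h4 := h.norm_act_sq_le b
    calc Δ * quad Q (act G b) ≤ Δ * (C * (H * ‖x‖ ^ 2 * ‖b‖ ^ 2)) := by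
          gcongr; refine h3.trans ?_; rw [mul_assoc, ← sq]; gcongr
      _ = (C * ‖x‖ ^ 2) * (Δ * H) * ‖b‖ ^ 2 := by ring
      _ ≤ (k * quad Q x) * (K * ε) * ‖b‖ ^ 2 := by gcongr
      _ = _ := by ring
  have h3 : 0 ≤ k * K * ε * ‖b‖ ^ 2 := by positivity
  have h4 : 0 ≤ k * K ^ 2 * ε * ‖b‖ ^ 2 := by positivity
  calc _ ≤ k * (2 * K + K ^ 2) * ε + k * K * ε * ‖b‖ ^ 2 :=
        (abs_add_le _ _).trans (add_le_add h1 h2)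
    _ ≤ _ := by linarith

theorem odd_part_sq_le (h : IsSmallStep Q C k K ε Δ H x F G) (b : EuclideanSpace ℝ (Fin d)) :
    4 * Δ / quad Q x ^ 2 * bform Q (x + Δ • F) (act G b) ^ 2
      ≤ ε * (4 * k ^ 2 * K * (1 + K) ^ 2 * (1 + ‖b‖ ^ 2)) := by
  obtain ⟨hQ, hC, hb, hk, hK, hε0, hε1, hΔ, hH, hΔH, hq0, hNq, hF, hG⟩ := id h
  have h0 := h.step_mul_nonneg
  have hy := h.norm_add_drift_le
  have ha := h.norm_act_sq_le b
  have h1 : bform Q (x + Δ • F) (act G b) ^ 2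
      ≤ C ^ 2 * ((1 + K) * ‖x‖) ^ 2 * (H * ‖x‖ ^ 2 * ‖b‖ ^ 2) := by
    rw [← sq_abs]
    calc |bform Q (x + Δ • F) (act G b)| ^ 2 ≤ (C * ((1 + K) * ‖x‖) * ‖act G b‖) ^ 2 := by
          gcongr; exact (hb _ _).trans (by gcongr)
      _ = C ^ 2 * ((1 + K) * ‖x‖) ^ 2 * ‖act G b‖ ^ 2 := by ring
      _ ≤ _ := by gcongr
  rw [div_mul_eq_mul_div, div_le_iff₀ (by positivity)]
  calc 4 * Δ * bform Q (x + Δ • F) (act G b) ^ 2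
      ≤ 4 * Δ * (C ^ 2 * ((1 + K) * ‖x‖) ^ 2 * (H * ‖x‖ ^ 2 * ‖b‖ ^ 2)) := by gcongr
    _ = 4 * (1 + K) ^ 2 * (C * ‖x‖ ^ 2) ^ 2 * (Δ * H) * ‖b‖ ^ 2 := by ring
    _ ≤ 4 * (1 + K) ^ 2 * (k * quad Q x) ^ 2 * (K * ε) * (1 + ‖b‖ ^ 2) := by
        gcongr; linarith
    _ = _ := by ring

/-- The odd part of a step involves the drifted point `x + Δ F`, while the stability assumption
concerns `x`. Exchanging one for the other costs only `ε²`. -/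
theorem abs_row_sub_le (h : IsSmallStep Q C k K ε Δ H x F G) :
    |‖row Q G (x + Δ • F)‖ ^ 2 - ‖row Q G x‖ ^ 2| * Δ
      ≤ k ^ 2 * K * (2 * K + K ^ 2) * ε ^ 2 * quad Q x ^ 2 := by
  obtain ⟨hQ, hC, hb, hk, hK, hε0, hε1, hΔ, hH, hΔH, hq0, hNq, hF, hG⟩ := id h
  have h0 := h.step_mul_nonneg
  have h1 : row Q G (x + Δ • F) = row Q G x + row Q G (Δ • F) := row_add _ _ _ _
  have hT := traceNorm_nonneg G
  have hd := h.norm_smul_drift_le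
  have h2 : ‖row Q G x‖ ≤ C * ‖x‖ * traceNorm G := norm_row_le hC hb x
  have h3 : ‖row Q G (Δ • F)‖ ≤ C * (Δ * H * ‖x‖) * traceNorm G :=
    (norm_row_le hC hb _).trans (by gcongr)
  have h4 : |‖row Q G (x + Δ • F)‖ ^ 2 - ‖row Q G x‖ ^ 2| ≤
      2 * (‖row Q G x‖ * ‖row Q G (Δ • F)‖) + ‖row Q G (Δ • F)‖ ^ 2 := by
    rw [h1, norm_add_sq_real]
    have h5 := abs_le.1 (abs_real_inner_le_norm (row Q G x) (row Q G (Δ • F)))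
    have h6 := sq_nonneg ‖row Q G (Δ • F)‖
    exact abs_le.2 ⟨by linarith, by linarith⟩
  have h5 : (K * ε) ^ 2 ≤ K ^ 2 * ε := by
    rw [mul_pow]; exact mul_le_mul_of_nonneg_left (by nlinarith) (sq_nonneg K)
  calc |‖row Q G (x + Δ • F)‖ ^ 2 - ‖row Q G x‖ ^ 2| * Δ
      ≤ (2 * ((C * ‖x‖ * traceNorm G) * (C * (Δ * H * ‖x‖) * traceNorm G))
        + (C * (Δ * H * ‖x‖) * traceNorm G) ^ 2) * Δ := by
        gcongr; exact h4.trans (by gcongr)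
    _ = (C * ‖x‖) ^ 2 * traceNorm G ^ 2 * Δ * (2 * (Δ * H) + (Δ * H) ^ 2) := by ring
    _ ≤ (C * ‖x‖) ^ 2 * (H * ‖x‖ ^ 2) * Δ * (2 * (Δ * H) + (Δ * H) ^ 2) := by gcongr
    _ = (C * ‖x‖ ^ 2) ^ 2 * (Δ * H) * (2 * (Δ * H) + (Δ * H) ^ 2) := by ring
    _ ≤ (k * quad Q x) ^ 2 * (K * ε) * (2 * (K * ε) + (K * ε) ^ 2) := by gcongr
    _ ≤ (k * quad Q x) ^ 2 * (K * ε) * (2 * (K * ε) + K ^ 2 * ε) := by gcongr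
    _ = _ := by ring

/-- The first-order term and the Itô correction combine, with `q = xᵀQx`, to `(sΔ/q²) (q ψ - (2 -
2s) |xᵀQG|²)`. Since `2s ≤ ρ`, this is at most the expression in the stability assumption, hence at
most `s β Δ`. The rest, `Δ² FᵀQF` and the exchange of `x + Δ F` for `x`, is of order `ε²`. -/
theorem second_order_le (h : IsSmallStep Q C k K ε Δ H x F G) {s ρ β : ℝ} (hs : 0 < s)
    (hρ : 2 * s ≤ ρ)
    (hβ : quad Q x * (2 * bform Q x F + (Gᵀ * Q * G).trace) - (2 - ρ) * ‖row Q G x‖ ^ 2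
      ≤ β * quad Q x ^ 2) :
    s * ((2 * Δ * bform Q x F + Δ ^ 2 * quad Q F) / quad Q x + Δ / quad Q x * (Gᵀ * Q * G).trace)
      + s * (s - 1) / 2 * (4 * Δ / quad Q x ^ 2 * ‖row Q G (x + Δ • F)‖ ^ 2)
      ≤ s * β * Δ + (s * k * K ^ 2 + 2 * |s * (s - 1)| * k ^ 2 * K * (2 * K + K ^ 2)) * ε ^ 2 := by
  have hrow := h.abs_row_sub_le
  have hFF := h.quad_drift_le
  obtain ⟨hQ, hC, hb, hk, hK, hε0, hε1, hΔ, hH, hΔH, hq0, hNq, hF, hG⟩ := id h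
  generalize quad Q x = q at *
  generalize ‖row Q G (x + Δ • F)‖ ^ 2 = wy at *
  have hwx := sq_nonneg ‖row Q G x‖
  generalize ‖row Q G x‖ ^ 2 = wx at *
  generalize (Gᵀ * Q * G).trace = tr at *
  generalize bform Q x F = bxF at *
  have hmain : s * ((2 * Δ * bxF) / q + Δ / q * tr)
      + s * (s - 1) / 2 * (4 * Δ / q ^ 2 * wx) ≤ s * β * Δ := by
    have h1 : s * ((2 * Δ * bxF) / q + Δ / q * tr) + s * (s - 1) / 2 * (4 * Δ / q ^ 2 * wx)
        = s * Δ / q ^ 2 * (q * (2 * bxF + tr) - (2 - 2 * s) * wx) := by field_simp; ring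
    rw [h1]
    calc _ ≤ s * Δ / q ^ 2 * (β * q ^ 2) := by
          gcongr
          nlinarith
      _ = _ := by field_simp
  have hF2 : s * (Δ ^ 2 * quad Q F / q) ≤ s * (k * K ^ 2 * ε ^ 2) :=
    mul_le_mul_of_nonneg_left ((div_le_iff₀ hq0).2 hFF) hs.le
  have hR : s * (s - 1) / 2 * (4 * Δ / q ^ 2 * (wy - wx))
      ≤ 2 * |s * (s - 1)| * (k ^ 2 * K * (2 * K + K ^ 2) * ε ^ 2) := by
    refine (le_abs_self _).trans ?_
    have h1 : |s * (s - 1) / 2 * (4 * Δ / q ^ 2 * (wy - wx))|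
        = 2 * |s * (s - 1)| * ((|wy - wx| * Δ) / q ^ 2) := by
      rw [abs_mul, abs_div, abs_mul (4 * Δ / q ^ 2), abs_two,
        abs_of_pos (by positivity : 0 < 4 * Δ / q ^ 2)]
      ring
    rw [h1]
    gcongr
    rw [div_le_iff₀ (by positivity)]
    exact hrow
  have e1 : s * ((2 * Δ * bxF + Δ ^ 2 * quad Q F) / q + Δ / q * tr)
      = s * ((2 * Δ * bxF) / q + Δ / q * tr) + s * (Δ ^ 2 * quad Q F / q) := by ring
  have e2 : s * (s - 1) / 2 * (4 * Δ / q ^ 2 * wy)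
      = s * (s - 1) / 2 * (4 * Δ / q ^ 2 * wx)
        + s * (s - 1) / 2 * (4 * Δ / q ^ 2 * (wy - wx)) := by ring
  rw [e1, e2]
  linarith

/-- This has the form `q (1 + A + v)` with `A` even and `v` odd in `b`, as the symmetrised binomial
bound requires. -/
theorem quad_step (h : IsSmallStep Q C k K ε Δ H x F G) (b : EuclideanSpace ℝ (Fin d)) :
    quad Q (x + Δ • F + act G (√Δ • b)) = quad Q x *
      (1 + ((2 * Δ * bform Q x F + Δ ^ 2 * quad Q F) / quad Q x + Δ / quad Q x * quad Q (act G b))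
        + 2 * √Δ * bform Q (x + Δ • F) (act G b) / quad Q x) := by
  have hq0 := h.quad_pos.ne'
  rw [act_smul, quad_add h.isSymm, bform_smul_right, quad_smul, Real.sq_sqrt h.step_pos.le,
    h.quad_add_drift]
  generalize quad Q x = q at *
  field_simp
  ring

end IsSmallStep

theorem exists_quad_rpow_symm_le (s K k : ℝ) (hs : 0 < s) (hK : 0 ≤ K) (hk : 0 ≤ k) :
    ∃ C₀ K' : ℝ, 0 ≤ C₀ ∧ 0 ≤ K' ∧ ∃ M : ℕ, ∀ {n d : ℕ} (Q : Matrix (Fin n) (Fin n) ℝ)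
      (C ε Δ H : ℝ) (x F : EuclideanSpace ℝ (Fin n)) (G : Matrix (Fin n) (Fin d) ℝ),
      IsSmallStep Q C k K ε Δ H x F G → ∀ b,
      quad Q (x + Δ • F + act G (√Δ • b)) ^ s + quad Q (x + Δ • F + act G (√Δ • -b)) ^ s
        ≤ 2 * (quad Q x ^ s * (1 + s * ((2 * Δ * bform Q x F + Δ ^ 2 * quad Q F) / quad Q x
            + Δ / quad Q x * quad Q (act G b))
          + s * (s - 1) / 2 * (4 * Δ / quad Q x ^ 2 * bform Q (x + Δ • F) (act G b) ^ 2)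
          + C₀ * ε ^ 2 * (1 + K' * (1 + ‖b‖ ^ 2)) ^ M)) := by
  obtain ⟨C₀, hC₀, M, hsym⟩ := exists_symm_one_add_rpow_le hs
  refine ⟨C₀ / 2, k * (2 * K + K ^ 2) + 4 * k ^ 2 * K * (1 + K) ^ 2, by positivity, by positivity,
    M, ?_⟩
  intro n d Q C ε Δ H x F G h b
  -- The sum of the constants bounding the even part and the square of the odd part, so that one `L
  -- = 1 + K' (1 + ‖b‖²)` serves both.
  set K' : ℝ := k * (2 * K + K ^ 2) + 4 * k ^ 2 * K * (1 + K) ^ 2 with hK'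
  have hK'0 : 0 ≤ K' := by positivity
  have hAbd := h.abs_even_part_le b
  have hvbd := h.odd_part_sq_le b
  have hplus := h.quad_step b
  have hminus := h.quad_step (-b)
  have hneg : act G (-b) = (-1 : ℝ) • act G b := by rw [← act_smul]; simp
  rw [hneg, quad_smul, bform_smul_right] at hminus
  have hq0 := h.quad_pos
  have hp0 := quad_nonneg h.posDef (x + Δ • F + act G (√Δ • b))
  have hm0 := quad_nonneg h.posDef (x + Δ • F + act G (√Δ • -b))
  have hτ : √Δ ^ 2 = Δ := Real.sq_sqrt h.step_pos.le
  have hε0 := h.eps_nonneg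
  generalize quad Q (x + Δ • F + act G (√Δ • b)) = qp at *
  generalize quad Q (x + Δ • F + act G (√Δ • -b)) = qm at *
  generalize bform Q (x + Δ • F) (act G b) = w at *
  rw [show ((-1 : ℝ) ^ 2 * quad Q (act G b)) = quad Q (act G b) by ring] at hminus
  generalize (2 * Δ * bform Q x F + Δ ^ 2 * quad Q F) / quad Q x
    + Δ / quad Q x * quad Q (act G b) = A at *
  generalize quad Q x = q at *
  have hv : 4 * Δ / q ^ 2 * w ^ 2 = (2 * √Δ * w / q) ^ 2 := by
    rw [div_pow, mul_pow, mul_pow, hτ]; ring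
  rw [hv] at hvbd ⊢
  have hm' : 2 * √Δ * (-1 * w) / q = -(2 * √Δ * w / q) := by ring
  rw [hm'] at hminus
  generalize 2 * √Δ * w / q = v at *
  -- Nonnegativity of the form keeps `A ± v` in the domain `ξ ≥ -1` of the binomial bound, however
  -- large `b` is.
  have hp1 : 0 ≤ 1 + A + v := nonneg_of_mul_nonneg_right (hplus ▸ hp0) hq0
  have hm1 : 0 ≤ 1 + A - v := by
    rw [sub_eq_add_neg]; exact nonneg_of_mul_nonneg_right (hminus ▸ hm0) hq0
  have hb0 : 0 ≤ 1 + ‖b‖ ^ 2 := by positivity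
  have hKb : 0 ≤ K' * (1 + ‖b‖ ^ 2) := by positivity
  have hA' : |A| ≤ ε * (1 + K' * (1 + ‖b‖ ^ 2)) := hAbd.trans <|
    mul_le_mul_of_nonneg_left (by
      have : 0 ≤ 4 * k ^ 2 * K * (1 + K) ^ 2 * (1 + ‖b‖ ^ 2) := by positivity
      rw [hK', add_mul]; linarith) hε0
  have hv' : v ^ 2 ≤ ε * (1 + K' * (1 + ‖b‖ ^ 2)) := hvbd.trans <|
    mul_le_mul_of_nonneg_left (by
      have : 0 ≤ k * (2 * K + K ^ 2) * (1 + ‖b‖ ^ 2) := by positivity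
      rw [hK', add_mul]; linarith) hε0
  have h3 := hsym ε (1 + K' * (1 + ‖b‖ ^ 2)) A v hε0 h.eps_le_one (by linarith) hA' hv'
    (by linarith) (by linarith)
  rw [hplus, hminus, ← sub_eq_add_neg, Real.mul_rpow hq0.le hp1, Real.mul_rpow hq0.le hm1,
    ← mul_add]
  calc q ^ s * ((1 + A + v) ^ s + (1 + A - v) ^ s)
      ≤ q ^ s * (2 * (1 + s * A + s * (s - 1) / 2 * v ^ 2)
        + C₀ * ε ^ 2 * (1 + K' * (1 + ‖b‖ ^ 2)) ^ M) :=
        mul_le_mul_of_nonneg_left h3 (Real.rpow_nonneg hq0.le s)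
    _ = _ := by ring

theorem integral_affine_combination {X : Type*} [MeasurableSpace X] {μ : Measure X}
    [IsProbabilityMeasure μ] {φ₁ φ₂ φ₃ : X → ℝ} (h₁ : Integrable φ₁ μ) (h₂ : Integrable φ₂ μ)
    (h₃ : Integrable φ₃ μ) (a s c e u w v : ℝ) :
    Integrable (fun b => a * (1 + s * (c + e * φ₁ b) + u * (w * φ₂ b) + v * φ₃ b)) μ ∧
    ∫ b, a * (1 + s * (c + e * φ₁ b) + u * (w * φ₂ b) + v * φ₃ b) ∂μ
      = a * (1 + s * (c + e * ∫ b, φ₁ b ∂μ) + u * (w * ∫ b, φ₂ b ∂μ) + v * ∫ b, φ₃ b ∂μ) := by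
  have key : ∀ y₁ y₂ y₃ : ℝ, a * (1 + s * (c + e * y₁) + u * (w * y₂) + v * y₃)
      = a * (1 + s * c) + a * s * e * y₁ + a * u * w * y₂ + a * v * y₃ := fun _ _ _ => by ring
  simp only [key]
  have i0 : Integrable (fun _ : X => a * (1 + s * c)) μ := integrable_const _
  have i1 := i0.add (h₁.const_mul (a * s * e))
  have i2 := i1.add (h₂.const_mul (a * u * w))
  have i3 := i2.add (h₃.const_mul (a * v))
  refine ⟨i3, ?_⟩
  refine (integral_add i2 (h₃.const_mul (a * v))).trans ?_
  rw [integral_const_mul]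
  congr 1
  refine (integral_add i1 (h₂.const_mul (a * u * w))).trans ?_
  rw [integral_const_mul]
  congr 1
  refine (integral_add i0 (h₁.const_mul (a * s * e))).trans ?_
  rw [integral_const_mul (a * s * e)]
  simp

theorem exists_lintegral_quad_rpow_le {n d : ℕ} {Q : Matrix (Fin n) (Fin n) ℝ} (hQ : Q.PosDef)
    {s ρ K θ : ℝ} (hs : 0 < s) (hρ : 2 * s ≤ ρ) (hK : 0 ≤ K) (hθ : 0 < θ) :
    ∃ C : ℝ, 0 ≤ C ∧ ∀ (Δ H β : ℝ) (x F : EuclideanSpace ℝ (Fin n)) (G : Matrix (Fin n) (Fin d) ℝ),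
      0 < Δ → Δ ≤ 1 → 0 ≤ H → Δ ^ (1 / 2 - θ) * H ≤ K → ‖F‖ ≤ H * ‖x‖ →
      traceNorm G ^ 2 ≤ H * ‖x‖ ^ 2 →
      quad Q x * (2 * bform Q x F + (Gᵀ * Q * G).trace) - (2 - ρ) * ‖row Q G x‖ ^ 2
        ≤ β * quad Q x ^ 2 →
      ∫⁻ b, ENNReal.ofReal (quad Q (x + Δ • F + act G (√Δ • b)) ^ s)
          ∂(stdGaussian (EuclideanSpace ℝ (Fin d)))
        ≤ ENNReal.ofReal (quad Q x ^ s * (1 + s * β * Δ + C * Δ ^ (1 + 2 * θ))) := by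
  obtain ⟨c, hc, hcq⟩ := exists_le_quad hQ
  obtain ⟨CQ, hCQ, hCQb⟩ := exists_bform_le Q
  obtain ⟨k, hk⟩ : ∃ k : ℝ, k = CQ / c := ⟨_, rfl⟩
  have hk0 : 0 ≤ k := by rw [hk]; positivity
  obtain ⟨C₀, K', hC₀, hK', M, hsym⟩ := exists_quad_rpow_symm_le s K k hs hK hk0
  obtain ⟨mom, hmom⟩ : ∃ mom : ℝ, mom = ∫ b, (1 + K' * (1 + ‖b‖ ^ 2)) ^ M
    ∂(stdGaussian (EuclideanSpace ℝ (Fin d))) := ⟨_, rfl⟩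
  have hmom0 : 0 ≤ mom := by rw [hmom]; exact integral_nonneg fun b => by positivity
  refine ⟨s * k * K ^ 2 + 2 * |s * (s - 1)| * k ^ 2 * K * (2 * K + K ^ 2) + C₀ * mom,
    by positivity, ?_⟩
  intro Δ H β x F G hΔ hΔ1 hH hHK hF hG hβ
  -- At the origin one cannot divide by the form, but the growth bounds force the step to stay at
  -- `0`.
  rcases eq_or_ne x 0 with rfl | hx
  · have hF0 : F = 0 := by simpa using hF
    have hG0 : traceNorm G = 0 := by
      have : traceNorm G ^ 2 ≤ 0 := by simpa using hG
      exact pow_eq_zero_iff two_ne_zero |>.1 (le_antisymm this (sq_nonneg _))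
    have hact : ∀ b, act G b = 0 := fun b => by
      have := norm_act_le G b
      rw [hG0, zero_mul] at this
      exact norm_le_zero_iff.1 this
    simp [hact, hF0, quad, hs.ne']
  -- With `ε = Δ^{1/2+θ}`, `Δ H = (Δ^{1/2-θ} H) ε ≤ K ε`, and the error `ε² = Δ^{1+2θ}` is of higher
  -- order than `Δ`.
  have hstep : IsSmallStep Q CQ k K (Δ ^ (1 / 2 + θ)) Δ H x F G := by
    refine ⟨hQ, hCQ.le, hCQb, hk0, hK, by positivity, Real.rpow_le_one hΔ.le hΔ1 (by linarith), hΔ,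
      hH, ?_, quad_pos hQ hx, ?_, hF, hG⟩
    · have h1 : Δ = Δ ^ (1 / 2 - θ) * Δ ^ (1 / 2 + θ) := by
        rw [← Real.rpow_add hΔ]; norm_num
      calc Δ * H = (Δ ^ (1 / 2 - θ) * H) * Δ ^ (1 / 2 + θ) := by nth_rewrite 1 [h1]; ring
        _ ≤ _ := by gcongr
    · rw [hk, div_mul_eq_mul_div, le_div_iff₀ hc]
      have := mul_le_mul_of_nonneg_left (hcq x) hCQ.le
      linarith
  have hεε : (Δ ^ (1 / 2 + θ)) ^ 2 = Δ ^ (1 + 2 * θ) := by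
    rw [← Real.rpow_natCast, ← Real.rpow_mul hΔ.le]; congr 1; push_cast; ring
  have hbound := hsym Q _ _ _ _ x F G hstep
  have h2 := hstep.second_order_le hs hρ hβ
  rw [hεε] at h2
  rw [hεε] at hbound
  have hq0 := hstep.quad_pos
  obtain ⟨hiq, hvq⟩ := integral_quad_act Q G
  have hvv := integral_inner_mul_inner_stdGaussian (row Q G (x + Δ • F)) (row Q G (x + Δ • F))
  rw [real_inner_self_eq_norm_sq] at hvv
  simp only [bform_act, sq (inner ℝ _ _)] at hbound
  have hmeas : Measurable fun b => quad Q (x + Δ • F + act G (√Δ • b)) ^ s := by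
    have h3 := continuous_quad Q
    have h4 := continuous_act G
    have : Continuous fun b => quad Q (x + Δ • F + act G (√Δ • b)) := by fun_prop
    exact this.measurable.pow_const s
  obtain ⟨hψ, hψv⟩ := integral_affine_combination hiq
    (integrable_inner_mul_inner_stdGaussian (row Q G (x + Δ • F)) (row Q G (x + Δ • F)))
    (integrable_one_add_norm_pow_stdGaussian (d := d) K' M) (quad Q x ^ s) s
    ((2 * Δ * bform Q x F + Δ ^ 2 * quad Q F) / quad Q x) (Δ / quad Q x) (s * (s - 1) / 2)
    (4 * Δ / quad Q x ^ 2) (C₀ * Δ ^ (1 + 2 * θ))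
  refine (lintegral_stdGaussian_le_of_symm hmeas
    (fun b => Real.rpow_nonneg (quad_nonneg hQ _) _) hψ hbound).trans
    (ENNReal.ofReal_le_ofReal ?_)
  rw [hψv, hvq, hvv, ← hmom]
  refine mul_le_mul_of_nonneg_left ?_ (Real.rpow_nonneg hq0.le s)
  linarith

/-! ### The truncation map and linear growth on its range. -/

section Truncation

variable {n d m : ℕ}

theorem enorm_trunc (R : ℝ≥0∞) (x : EuclideanSpace ℝ (Fin n)) :
    ‖trunc R x‖ₑ = min ‖x‖ₑ R := by
  rcases eq_or_ne x 0 with rfl | hx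
  · simp [trunc]
  · have h1 : ‖‖x‖⁻¹ • x‖ = 1 := by simp [norm_smul, hx]
    have h2 : min ‖x‖ₑ R ≠ ⊤ := ne_top_of_le_ne_top enorm_ne_top (min_le_left _ _)
    have h3 : ‖trunc R x‖ = (min ‖x‖ₑ R).toReal := by
      rw [trunc, norm_smul, h1, mul_one, Real.norm_of_nonneg ENNReal.toReal_nonneg]
    rw [← ofReal_norm, h3, ENNReal.ofReal_toReal h2]

theorem exists_trunc_eq_smul (R : ℝ≥0∞) (x : EuclideanSpace ℝ (Fin n)) :
    ∃ t : ℝ, 0 ≤ t ∧ t ≤ 1 ∧ trunc R x = t • x := by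
  refine ⟨(min ‖x‖ₑ R).toReal * ‖x‖⁻¹, by positivity, ?_, by rw [trunc, smul_smul]⟩
  have : (min ‖x‖ₑ R).toReal ≤ ‖x‖ := by
    rw [← toReal_enorm x]
    exact ENNReal.toReal_mono enorm_ne_top (min_le_left _ _)
  rw [← div_eq_mul_inv]
  exact div_le_one_of_le₀ this (norm_nonneg _)

theorem quad_trunc_le {Q : Matrix (Fin n) (Fin n) ℝ} (hQ : Q.PosDef) (R : ℝ≥0∞)
    (x : EuclideanSpace ℝ (Fin n)) : quad Q (trunc R x) ≤ quad Q x := by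
  obtain ⟨t, ht0, ht1, h⟩ := exists_trunc_eq_smul R x
  rw [h, quad_smul]
  exact mul_le_of_le_one_left (quad_nonneg hQ x) (pow_le_one₀ ht0 ht1)

theorem measurable_trunc (R : ℝ≥0∞) :
    Measurable (trunc R : EuclideanSpace ℝ (Fin n) → EuclideanSpace ℝ (Fin n)) := by
  unfold trunc
  fun_prop

variable {f : EuclideanSpace ℝ (Fin n) → Fin m → EuclideanSpace ℝ (Fin n)}
  {g : EuclideanSpace ℝ (Fin n) → Fin m → Matrix (Fin n) (Fin d) ℝ} {φ : Fin m → ℝ → ℝ}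

/-- The control function does not exceed the truncation level on the truncation ball. -/
theorem IsLipschitzControl.le_of_ofReal_le_truncRadius (hφ : IsLipschitzControl f g φ) (i : Fin m)
    {u u₀ v : ℝ} (hu : 0 < u) (hu₀ : 0 ≤ u₀) (hv : φ i u₀ ≤ v)
    (h : ENNReal.ofReal u ≤ truncRadius (φ i) v) : φ i u ≤ v := by
  rcases hφ.shape i with ⟨hmono, hcont, -⟩ | ⟨C, hC⟩
  -- If `φ i u > v`, continuity gives `w < u` with `φ i w > v`. By monotonicity the supremum
  -- defining the radius is then at most `w`.
  · by_contra! hlt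
    have h1 : ∀ᶠ w in 𝓝[<] u, v < φ i w := by
      have h2 : ContinuousAt (φ i) u := hcont.continuousAt (Ici_mem_nhds hu)
      exact (h2.eventually (lt_mem_nhds hlt)).filter_mono nhdsWithin_le_nhds
    have h2 : ∀ᶠ w in 𝓝[<] u, 0 < w := (lt_mem_nhds hu).filter_mono nhdsWithin_le_nhds
    obtain ⟨w, ⟨hw, hw0⟩, hwu⟩ := ((h1.and h2).and self_mem_nhdsWithin).exists
    have hwu' : w < u := hwu
    have h3 : truncRadius (φ i) v ≤ ENNReal.ofReal w := by
      refine iSup₂_le fun y hy => ?_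
      have : (y : ℝ) ≤ w := by
        by_contra! hyw
        have := hmono hw0.le (y.2 : (y : ℝ) ∈ Set.Ici (0 : ℝ)) hyw
        exact lt_irrefl _ (hw.trans (this.trans_le hy))
      rw [← ENNReal.ofReal_coe_nnreal]
      exact ENNReal.ofReal_le_ofReal this
    have h4 := (ENNReal.ofReal_le_ofReal_iff hw0.le).1 (h.trans h3)
    linarith
  · rwa [hC u hu.le, ← hC u₀ hu₀]

theorem ofReal_le_truncRadius {ψ : ℝ → ℝ} {u v : ℝ} (hu : 0 ≤ u) (h : ψ u ≤ v) :
    ENNReal.ofReal u ≤ truncRadius ψ v :=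
  le_iSup₂_of_le (f := fun (u : ℝ≥0) (_ : ψ u ≤ v) => (u : ℝ≥0∞)) u.toNNReal
    (by rwa [Real.coe_toNNReal u hu]) le_rfl

/-- On the range of the truncation map, the coefficients have linear growth, with a constant given
by the truncation level. -/
theorem IsLipschitzControl.growth_trunc (hφ : IsLipschitzControl f g φ) (hf : ∀ i, f 0 i = 0)
    (hg : ∀ i, g 0 i = 0) {u₀ v : ℝ} (hu₀ : 1 ≤ u₀) (i : Fin m) (hv : φ i u₀ ≤ v)
    (x : EuclideanSpace ℝ (Fin n)) :
    ‖f (trunc (truncRadius (φ i) v) x) i‖ ≤ v * ‖trunc (truncRadius (φ i) v) x‖ ∧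
    traceNorm (g (trunc (truncRadius (φ i) v) x) i) ^ 2
      ≤ v * ‖trunc (truncRadius (φ i) v) x‖ ^ 2 := by
  have hz := enorm_trunc (truncRadius (φ i) v) x
  generalize trunc (truncRadius (φ i) v) x = z at *
  rcases eq_or_ne z 0 with rfl | hz0
  · simp [hf, hg, traceNorm]
  -- The Lipschitz control starts at radius `1`, hence the maximum. The radius is at least `1`
  -- because the level `v` dominates `φ i u₀` with `u₀ ≥ 1`.
  have h1 : ENNReal.ofReal (max ‖z‖ 1) ≤ truncRadius (φ i) v := by
    rw [ENNReal.ofReal_max]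
    refine max_le ?_ ?_
    · rw [ofReal_norm, hz]; exact min_le_right _ _
    · exact (ENNReal.ofReal_le_ofReal hu₀).trans (ofReal_le_truncRadius (by linarith) hv)
  have h2 := hφ.le_of_ofReal_le_truncRadius i (u := max ‖z‖ 1) (by positivity) (by linarith) hv h1
  have h3 := (hφ.bound i (max ‖z‖ 1) (le_max_right _ _) z 0 (by simp) hz0).trans h2
  simp only [hf, hg, sub_zero] at h3
  have hz' : 0 < ‖z‖ := norm_pos_iff.2 hz0
  exact ⟨(div_le_iff₀ hz').1 ((le_max_left _ _).trans h3),
    (div_le_iff₀ (by positivity)).1 ((le_max_right _ _).trans h3)⟩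

end Truncation

/-! ### Measurability of the scheme in the chain and the increments. -/

section Measurability

variable {n d m : ℕ} {f : EuclideanSpace ℝ (Fin n) → Fin m → EuclideanSpace ℝ (Fin n)}
  {g : EuclideanSpace ℝ (Fin n) → Fin m → Matrix (Fin n) (Fin d) ℝ}

theorem abs_apply_le_traceNorm (A : Matrix (Fin n) (Fin d) ℝ) (i : Fin n) (a : Fin d) :
    |A i a| ≤ traceNorm A := by
  refine abs_le_of_sq_le_sq ?_ (traceNorm_nonneg A)
  rw [traceNorm_sq]
  exact (Finset.single_le_sum (f := fun a => A i a ^ 2) (fun _ _ => sq_nonneg _)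
    (Finset.mem_univ a)).trans (Finset.single_le_sum (f := fun i => ∑ a, A i a ^ 2)
      (fun _ _ => Finset.sum_nonneg fun _ _ => sq_nonneg _) (Finset.mem_univ i))

theorem continuous_of_lipschitz_on_balls {E F : Type*} [NormedAddCommGroup E]
    [NormedAddCommGroup F] {u : E → F}
    (h : ∀ N : ℝ, 0 < N → ∃ C : ℝ, ∀ x y : E, max ‖x‖ ‖y‖ ≤ N → ‖u x - u y‖ ≤ C * ‖x - y‖) :
    Continuous u := by
  refine continuous_iff_continuousAt.2 fun x => ?_
  obtain ⟨C, hC⟩ := h (‖x‖ + 1) (by positivity)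
  rw [ContinuousAt, tendsto_iff_norm_sub_tendsto_zero]
  have h1 : Tendsto (fun y => C * ‖y - x‖) (𝓝 x) (𝓝 0) := by
    have : Continuous fun y => C * ‖y - x‖ := by fun_prop
    simpa using this.tendsto x
  refine squeeze_zero' (Eventually.of_forall fun _ => norm_nonneg _) ?_ h1
  have h2 : ∀ᶠ y in 𝓝 x, ‖y‖ < ‖x‖ + 1 :=
    continuous_norm.continuousAt.eventually (gt_mem_nhds (by linarith))
  filter_upwards [h2] with y hy
  exact hC y x (max_le hy.le (by linarith))

theorem IsLocallyLipschitz.continuous_drift (h : IsLocallyLipschitz f g) (i : Fin m) :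
    Continuous fun x => f x i :=
  continuous_of_lipschitz_on_balls fun N hN => by
    obtain ⟨C, -, hC⟩ := h N hN
    exact ⟨C, fun x y hxy => (le_max_left _ _).trans (hC x y hxy i)⟩

theorem IsLocallyLipschitz.continuous_diffusion (h : IsLocallyLipschitz f g) (i : Fin m)
    (a : Fin n) (c : Fin d) : Continuous fun x => g x i a c :=
  continuous_of_lipschitz_on_balls fun N hN => by
    obtain ⟨C, -, hC⟩ := h N hN
    exact ⟨C, fun x y hxy => (abs_apply_le_traceNorm (g x i - g y i) a c).trans
      ((le_max_right _ _).trans (hC x y hxy i))⟩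

theorem IsLocallyLipschitz.measurable_act (h : IsLocallyLipschitz f g) (i : Fin m) :
    Measurable fun z : EuclideanSpace ℝ (Fin n) × EuclideanSpace ℝ (Fin d) =>
      act (g z.1 i) z.2 := by
  have h1 := h.continuous_diffusion i
  unfold act
  have : Continuous fun z : EuclideanSpace ℝ (Fin n) × EuclideanSpace ℝ (Fin d) =>
      (WithLp.toLp 2 fun a => ∑ c, g z.1 i a c * z.2 c : EuclideanSpace ℝ (Fin n)) := by
    fun_prop
  exact this.measurable

/-- One step of the scheme before truncation, in state `i`, from the truncation `z`. -/
def emStep (f : EuclideanSpace ℝ (Fin n) → Fin m → EuclideanSpace ℝ (Fin n))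
    (g : EuclideanSpace ℝ (Fin n) → Fin m → Matrix (Fin n) (Fin d) ℝ) (Δ : ℝ) (i : Fin m)
    (z : EuclideanSpace ℝ (Fin n)) (b : EuclideanSpace ℝ (Fin d)) : EuclideanSpace ℝ (Fin n) :=
  z + Δ • f z i + act (g z i) b

theorem IsLocallyLipschitz.measurable_emStep (h : IsLocallyLipschitz f g) (Δ : ℝ) (i : Fin m) :
    Measurable fun z : EuclideanSpace ℝ (Fin n) × EuclideanSpace ℝ (Fin d) =>
      emStep f g Δ i z.1 z.2 := by
  have h1 := (h.continuous_drift i).measurable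
  have h2 := h.measurable_act i
  unfold emStep
  fun_prop

variable (φ : Fin m → ℝ → ℝ) (hlev : ℝ → ℝ) (x₀ : EuclideanSpace ℝ (Fin n)) (Δ : ℝ)

theorem preScheme_succ (r : ℕ → Fin m) (b : ℕ → EuclideanSpace ℝ (Fin d)) (k : ℕ) :
    preScheme f g φ hlev x₀ Δ r b (k + 1) = emStep f g Δ (r k)
      (trunc (truncRadius (φ (r k)) (hlev Δ)) (preScheme f g φ hlev x₀ Δ r b k)) (b k) := rfl

theorem IsLocallyLipschitz.measurable_preScheme (h : IsLocallyLipschitz f g) (k : ℕ) :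
    Measurable fun z : (ℕ → Fin m) × (ℕ → EuclideanSpace ℝ (Fin d)) =>
      preScheme f g φ hlev x₀ Δ z.1 z.2 k := by
  induction k with
  | zero => exact measurable_const
  | succ k ih =>
    simp only [preScheme_succ]
    have h1 : Measurable fun y : Fin m × (EuclideanSpace ℝ (Fin n) × EuclideanSpace ℝ (Fin d)) =>
        emStep f g Δ y.1 (trunc (truncRadius (φ y.1) (hlev Δ)) y.2.1) y.2.2 :=
      measurable_from_prod_countable_right fun i => by
        have h2 : Measurable fun y : EuclideanSpace ℝ (Fin n) × EuclideanSpace ℝ (Fin d) =>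
            (trunc (truncRadius (φ i) (hlev Δ)) y.1, y.2) :=
          ((measurable_trunc _).comp measurable_fst).prodMk measurable_snd
        exact (h.measurable_emStep Δ i).comp h2
    have h2 : Measurable fun z : (ℕ → Fin m) × (ℕ → EuclideanSpace ℝ (Fin d)) => z.1 k :=
      (measurable_pi_apply k).comp measurable_fst
    have h3 : Measurable fun z : (ℕ → Fin m) × (ℕ → EuclideanSpace ℝ (Fin d)) => z.2 k :=
      (measurable_pi_apply k).comp measurable_snd
    have h4 : ∀ X : (ℕ → Fin m) × (ℕ → EuclideanSpace ℝ (Fin d)) → EuclideanSpace ℝ (Fin n),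
        Measurable X → Measurable fun z => emStep f g Δ (z.1 k)
          (trunc (truncRadius (φ (z.1 k)) (hlev Δ)) (X z)) (z.2 k) := fun X hX => by
      have h5 := h1.comp (h2.prodMk (hX.prodMk h3))
      rw [Function.comp_def] at h5
      dsimp only at h5
      exact h5
    exact h4 _ ih

/-- Adaptedness: the value at time `k` ignores the increments from index `k` on, which makes it
independent of the next one. -/
theorem preScheme_congr (r : ℕ → Fin m) {b b' : ℕ → EuclideanSpace ℝ (Fin d)} {k : ℕ}
    (h : ∀ j < k, b j = b' j) :
    preScheme f g φ hlev x₀ Δ r b k = preScheme f g φ hlev x₀ Δ r b' k := by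
  induction k with
  | zero => rfl
  | succ k ih =>
    rw [preScheme_succ, preScheme_succ, ih fun j hj => h j (by omega), h k (by omega)]

end Measurability

/-! ### Brownian increments: law and independence. -/

section Increments

variable {Ω : Type*} [MeasurableSpace Ω] {P : Measure Ω} {d : ℕ}
  {B : ℝ≥0 → Ω → EuclideanSpace ℝ (Fin d)}

/-- The increment of `B` over the `k`-th interval of length `τ`. -/
def increment (B : ℝ≥0 → Ω → EuclideanSpace ℝ (Fin d)) (τ : ℝ≥0) (k : ℕ) (ω : Ω) :
    EuclideanSpace ℝ (Fin d) :=
  B ((k + 1) * τ) ω - B (k * τ) ω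

namespace IsBrownianMotion

theorem measurable_increment (hB : IsBrownianMotion P B) (τ : ℝ≥0) (k : ℕ) :
    Measurable (increment B τ k) :=
  (hB.measurable _).sub (hB.measurable _)

theorem measurable_increment_apply (hB : IsBrownianMotion P B) (τ : ℝ≥0) (k : ℕ) (a : Fin d) :
    Measurable fun ω => increment B τ k ω a := by
  have := hB.measurable_increment τ k
  fun_prop

/-- Independence of the coordinate paths and of the increments along each coordinate combine into
independence over all pairs. -/
theorem iIndepFun_increment (hB : IsBrownianMotion P B) (τ : ℝ≥0) :
    iIndepFun (fun (q : Fin d × ℕ) ω => increment B τ q.2 ω q.1) P := by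
  refine iIndepFun_uncurry' (X := fun (a : Fin d) (k : ℕ) ω => increment B τ k ω a)
    (fun a k => hB.measurable_increment_apply τ k a) ?_ fun a => ?_
  · have h1 := hB.indep.comp (fun _ (path : ℝ≥0 → ℝ) (k : ℕ) => path ((k + 1) * τ) - path (k * τ))
      fun _ => by fun_prop
    exact h1
  · have h1 := (hB.coord a).hasIndepIncrements.nat (t := fun k : ℕ => (k : ℝ≥0) * τ)
      (fun i j hij => by dsimp only; gcongr)
    simpa [increment] using h1

theorem hasLaw_increment (hB : IsBrownianMotion P B) (τ : ℝ≥0) (k : ℕ) (a : Fin d) :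
    HasLaw (fun ω => increment B τ k ω a) (gaussianReal 0 τ) P := by
  have h1 := (hB.coord a).hasLaw_sub ((k + 1) * τ) (k * τ)
  have h2 : nndist (((k + 1) * τ : ℝ≥0)).1 ((k * τ : ℝ≥0)).1 = τ := by
    ext
    simp [Real.dist_eq]
    ring_nf
    simp
  rw [h2] at h1
  exact h1

theorem map_increment [IsProbabilityMeasure P] (hB : IsBrownianMotion P B)
    (τ : ℝ≥0) (hτ : 0 < τ) (k : ℕ) :
    P.map (increment B τ k) = (stdGaussian (EuclideanSpace ℝ (Fin d))).map
      fun b => √(τ : ℝ) • b := by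
  have hsq : √(τ : ℝ) ≠ 0 := by
    have : (0 : ℝ) < τ := hτ
    positivity
  have hlaw : ∀ a, HasLaw (fun ω => (√(τ : ℝ))⁻¹ * increment B τ k ω a) (gaussianReal 0 1) P := by
    intro a
    have h1 := gaussianReal_const_mul (hB.hasLaw_increment τ k a) (√(τ : ℝ))⁻¹
    convert h1 using 2
    · simp
    · ext
      simp
      have : (τ : ℝ) ≠ 0 := by exact_mod_cast hτ.ne'
      field_simp
  have hind : iIndepFun (fun a ω => (√(τ : ℝ))⁻¹ * increment B τ k ω a) P := by
    have h1 := (hB.iIndepFun_increment τ).precomp (g := fun a : Fin d => (a, k))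
      (fun a a' h => (Prod.ext_iff.1 h).1)
    exact h1.comp (fun _ y => (√(τ : ℝ))⁻¹ * y) fun _ => by fun_prop
  have hm : ∀ a, Measurable fun ω => (√(τ : ℝ))⁻¹ * increment B τ k ω a := fun a =>
    (hB.measurable_increment_apply τ k a).const_mul _
  have h2 := (iIndepFun_iff_map_fun_eq_pi_map fun a => (hm a).aemeasurable).1 hind
  simp only [(hlaw _).map_eq] at h2
  rw [← map_pi_eq_stdGaussian, ← h2, Measure.map_map (by fun_prop) (by fun_prop),
    Measure.map_map (by fun_prop) (by fun_prop)]
  congr 1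
  ext ω a
  simp [hsq]

/-- A functional of the first `k` increments is independent of the next one. -/
theorem indepFun_increment (hB : IsBrownianMotion P B) (τ : ℝ≥0) (k : ℕ) {E : Type*}
    [MeasurableSpace E] {F : (ℕ → EuclideanSpace ℝ (Fin d)) → E} (hF : Measurable F)
    (hFk : ∀ b b' : ℕ → EuclideanSpace ℝ (Fin d), (∀ j < k, b j = b' j) → F b = F b') :
    IndepFun (fun ω => F fun j => increment B τ j ω) (increment B τ k) P := by
  classical
  set S : Finset (Fin d × ℕ) := Finset.univ ×ˢ Finset.range k with hS
  set T : Finset (Fin d × ℕ) := Finset.univ ×ˢ {k} with hT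
  have hST : Disjoint S T := by
    rw [Finset.disjoint_left]
    rintro ⟨a, j⟩ h1 h2
    simp [hS, hT] at h1 h2
    omega
  have h1 := (hB.iIndepFun_increment τ).indepFun_finset S T hST
    fun q => hB.measurable_increment_apply τ q.2 q.1
  -- Increments from index `k` on are replaced by zero; by `hFk` the functional `F` does not notice.
  let past : (S → ℝ) → ℕ → EuclideanSpace ℝ (Fin d) := fun v j => WithLp.toLp 2 fun a =>
    if h : (a, j) ∈ S then v ⟨(a, j), h⟩ else 0
  let present : (T → ℝ) → EuclideanSpace ℝ (Fin d) := fun v => WithLp.toLp 2 fun a =>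
    v ⟨(a, k), by simp [hT]⟩
  have hpast : Measurable past := by
    refine measurable_pi_lambda _ fun j => ?_
    refine (WithLp.measurable_toLp 2 _).comp (measurable_pi_lambda _ fun a => ?_)
    by_cases h : (a, j) ∈ S
    · simp only [h, dite_true]; exact measurable_pi_apply _
    · simp only [h, dite_false]; exact measurable_const
  have hpresent : Measurable present :=
    (WithLp.measurable_toLp 2 _).comp (measurable_pi_lambda _ fun a => measurable_pi_apply _)
  have h2 := h1.comp (hF.comp hpast) hpresent
  refine h2.congr (Eventually.of_forall fun ω => ?_) (Eventually.of_forall fun ω => rfl)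
  refine hFk _ _ fun j hj => ?_
  ext a
  have : (a, j) ∈ S := by simp [hS, hj]
  simp [past, this]

end IsBrownianMotion

end Increments

/-- Fubini for the product law. It is used both to freeze the past of the scheme and to freeze the
whole path of the chain. -/
theorem lintegral_indepFun {Ω X Y : Type*} [MeasurableSpace Ω] [MeasurableSpace X]
    [MeasurableSpace Y] {P : Measure Ω} [IsProbabilityMeasure P] {U : Ω → X} {W : Ω → Y}
    (hU : Measurable U) (hW : Measurable W) (h : IndepFun U W P) {F : X × Y → ℝ≥0∞}
    (hF : Measurable F) :
    ∫⁻ ω, F (U ω, W ω) ∂P = ∫⁻ ω, ∫⁻ y, F (U ω, y) ∂(P.map W) ∂P := by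
  have h1 := (indepFun_iff_map_prod_eq_prod_map_map hU.aemeasurable hW.aemeasurable).1 h
  have := Measure.isProbabilityMeasure_map (μ := P) hW.aemeasurable
  rw [← lintegral_map (f := F) hF (hU.prodMk hW), h1, lintegral_prod _ hF.aemeasurable,
    lintegral_map hF.lintegral_prod_right' hU]

/-! ### Multiplicative functionals of the chain on the time grid. -/

section Chain

variable {Ω : Type*} [MeasurableSpace Ω] {P : Measure Ω} {m : ℕ}
  {Γ : Matrix (Fin m) (Fin m) ℝ} {ℓ : Fin m} {r : ℝ≥0 → Ω → Fin m}

/-- The path of the chain observed at the first `k + 1` grid points. -/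
def gridPath (r : ℝ≥0 → Ω → Fin m) (τ : ℝ≥0) (k : ℕ) (ω : Ω) (j : Fin (k + 1)) : Fin m :=
  r ((j : ℕ) * τ) ω

theorem IsMarkovChain.measurable_gridPath (hr : IsMarkovChain P Γ ℓ r) (τ : ℝ≥0) (k : ℕ) :
    Measurable (gridPath r τ k) :=
  measurable_pi_lambda _ fun _ => hr.measurable _

theorem IsMarkovChain.real_gridPath_snoc (hr : IsMarkovChain P Γ ℓ r) (τ : ℝ≥0) (k : ℕ)
    (c : Fin (k + 1) → Fin m) (i : Fin m) :
    P.real {ω | gridPath r τ (k + 1) ω = Fin.snoc c i}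
      = P.real {ω | gridPath r τ k ω = c}
        * NormedSpace.exp ((τ : ℝ) • Γ) (c (Fin.last k)) i := by
  have key : ∀ (N : ℕ) (c : Fin (N + 1) → Fin m), P.real {ω | gridPath r τ N ω = c} =
      P.real {ω | r 0 ω = c 0} *
        ∏ j : Fin N, NormedSpace.exp ((τ : ℝ) • Γ) (c j.castSucc) (c j.succ) := by
    intro N c
    have h1 := hr.finite_dim N (fun j => (j : ℕ) * τ) (fun i j hij => by
      dsimp only; gcongr; exact hij) c
    have h2 : {ω | gridPath r τ N ω = c} = {ω | ∀ j : Fin (N + 1), r ((j : ℕ) * τ) ω = c j} := by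
      ext ω; simp [funext_iff, gridPath]
    rw [h2, h1]
    congr 1
    · simp
    · refine Finset.prod_congr rfl fun j _ => ?_
      have h3 : (((((j.succ : Fin (N + 1)) : ℕ) : ℝ≥0) * τ : ℝ≥0) : ℝ)
          - (((((j.castSucc : Fin (N + 1)) : ℕ) : ℝ≥0) * τ : ℝ≥0) : ℝ) = τ := by
        rw [Fin.val_succ, Fin.val_castSucc]
        push_cast
        ring
      rw [h3]
  have h0 : (Fin.snoc c i : Fin (k + 2) → Fin m) 0 = c 0 :=
    Fin.snoc_castSucc (α := fun _ => Fin m) i c 0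
  rw [key, key, Fin.prod_univ_castSucc, h0, ← mul_assoc]
  simp only [Fin.succ_castSucc, Fin.snoc_castSucc, Fin.succ_last, Fin.snoc_last]

theorem integral_gridPath [IsProbabilityMeasure P] (hr : IsMarkovChain P Γ ℓ r) (τ : ℝ≥0) (k : ℕ)
    (F : (Fin (k + 1) → Fin m) → ℝ) :
    ∫ ω, F (gridPath r τ k ω) ∂P = ∑ c, P.real {ω | gridPath r τ k ω = c} * F c := by
  have hm := hr.measurable_gridPath τ k
  have := Measure.isProbabilityMeasure_map (μ := P) hm.aemeasurable
  rw [← integral_map (f := F) hm.aemeasurable (measurable_of_finite F).aestronglyMeasurable,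
    integral_fintype Integrable.of_finite]
  refine Finset.sum_congr rfl fun c _ => ?_
  rw [smul_eq_mul, Measure.real, Measure.map_apply hm (measurableSet_singleton c)]
  rfl

theorem IsMarkovChain.integrable_prod [IsProbabilityMeasure P] (hr : IsMarkovChain P Γ ℓ r)
    (τ : ℝ≥0) (a ζ : Fin m → ℝ) (k : ℕ) :
    Integrable (fun ω => (∏ j ∈ Finset.range k, a (r (j * τ) ω)) * ζ (r (k * τ) ω)) P := by
  set G : (Fin (k + 1) → Fin m) → ℝ := fun c =>
    (∏ j : Fin k, a (c j.castSucc)) * ζ (c (Fin.last k)) with hG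
  have := Measure.isProbabilityMeasure_map (μ := P) (hr.measurable_gridPath τ k).aemeasurable
  have h0 : Integrable G (P.map (gridPath r τ k)) := Integrable.of_finite
  have h1 : Integrable (fun ω => G (gridPath r τ k ω)) P :=
    h0.comp_measurable (hr.measurable_gridPath τ k)
  refine h1.congr (Eventually.of_forall fun ω => ?_)
  dsimp only
  rw [← Fin.prod_univ_eq_prod_range (fun j => a (r (j * τ) ω)) k]
  simp [hG, gridPath]

/-- The Markov chain, weighted by the factors `a`, decays at least at the rate `κ` for which a
positive vector `ζ` is superharmonic. -/
theorem IsMarkovChain.integral_prod_le [IsProbabilityMeasure P] (hr : IsMarkovChain P Γ ℓ r)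
    (τ : ℝ≥0) {a ζ : Fin m → ℝ} {κ D : ℝ} (ha : ∀ i, 0 ≤ a i) (hD : ∀ i, ζ i ≤ D) (hκ : 0 ≤ κ)
    (h : ∀ i, a i * (NormedSpace.exp ((τ : ℝ) • Γ) *ᵥ ζ) i ≤ ζ i * κ) (k : ℕ) :
    ∫ ω, (∏ j ∈ Finset.range k, a (r (j * τ) ω)) * ζ (r (k * τ) ω) ∂P ≤ D * κ ^ k := by
  have hconv : ∀ k : ℕ, ∫ ω, (∏ j ∈ Finset.range k, a (r (j * τ) ω)) * ζ (r (k * τ) ω) ∂P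
      = ∑ c, P.real {ω | gridPath r τ k ω = c}
        * ((∏ j : Fin k, a (c j.castSucc)) * ζ (c (Fin.last k))) := by
    intro k
    rw [← integral_gridPath hr τ k fun c => (∏ j : Fin k, a (c j.castSucc)) * ζ (c (Fin.last k))]
    congr 1
    ext ω
    rw [← Fin.prod_univ_eq_prod_range (fun j => a (r (j * τ) ω)) k]
    simp [gridPath]
  induction k with
  | zero =>
    have h1 : ∫ ω, ζ (r ((0 : ℕ) * τ) ω) ∂P ≤ ∫ _, D ∂P := by
      exact integral_mono (Integrable.of_finite.comp_measurable (hr.measurable _))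
        (integrable_const _) fun ω => hD _
    simpa using h1
  | succ k ih =>
    -- Split off the last state. Summing it out turns `ζ` into `e^{τΓ} ζ` at the previous state,
    -- where together with the factor `a` it is at most `κ ζ`.
    rw [hconv, ← (Fin.snocEquiv fun _ => Fin m).sum_comp, Fintype.sum_prod_type_right]
    have h1 : ∀ c : Fin (k + 1) → Fin m, ∑ i : Fin m,
        P.real {ω | gridPath r τ (k + 1) ω = Fin.snoc c i}
          * ((∏ j : Fin (k + 1), a ((Fin.snoc c i : Fin (k + 2) → Fin m) j.castSucc))
            * ζ ((Fin.snoc c i : Fin (k + 2) → Fin m) (Fin.last (k + 1))))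
        ≤ κ * (P.real {ω | gridPath r τ k ω = c}
          * ((∏ j : Fin k, a (c j.castSucc)) * ζ (c (Fin.last k)))) := by
      intro c
      have h2 := h (c (Fin.last k))
      have h3 : 0 ≤ P.real {ω | gridPath r τ k ω = c} * ∏ j : Fin k, a (c j.castSucc) :=
        mul_nonneg measureReal_nonneg (Finset.prod_nonneg fun _ _ => ha _)
      calc _ = ∑ i : Fin m, (P.real {ω | gridPath r τ k ω = c} * ∏ j : Fin k, a (c j.castSucc))
            * (a (c (Fin.last k))
              * (NormedSpace.exp ((τ : ℝ) • Γ) (c (Fin.last k)) i * ζ i)) := by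
            refine Finset.sum_congr rfl fun i _ => ?_
            rw [hr.real_gridPath_snoc, Fin.snoc_last]
            simp only [Fin.snoc_castSucc]
            rw [Fin.prod_univ_castSucc]
            ring
        _ = (P.real {ω | gridPath r τ k ω = c} * ∏ j : Fin k, a (c j.castSucc))
            * (a (c (Fin.last k))
              * (NormedSpace.exp ((τ : ℝ) • Γ) *ᵥ ζ) (c (Fin.last k))) := by
            rw [← Finset.mul_sum, ← Finset.mul_sum]
            rfl
        _ ≤ (P.real {ω | gridPath r τ k ω = c} * ∏ j : Fin k, a (c j.castSucc))
            * (ζ (c (Fin.last k)) * κ) := mul_le_mul_of_nonneg_left h2 h3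
        _ = _ := by ring
    calc _ ≤ ∑ c, κ * (P.real {ω | gridPath r τ k ω = c}
          * ((∏ j : Fin k, a (c j.castSucc)) * ζ (c (Fin.last k)))) :=
          Finset.sum_le_sum fun c _ => h1 c
      _ ≤ κ * (D * κ ^ k) := by
          rw [← Finset.mul_sum, ← hconv]
          exact mul_le_mul_of_nonneg_left ih hκ
      _ = _ := by ring

end Chain

/-! ### Moment bounds given the path of the chain. -/

section Moments

variable {Ω : Type*} [MeasurableSpace Ω] {P : Measure Ω} [IsProbabilityMeasure P] {n d m : ℕ}
  {B : ℝ≥0 → Ω → EuclideanSpace ℝ (Fin d)}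
  {f : EuclideanSpace ℝ (Fin n) → Fin m → EuclideanSpace ℝ (Fin n)}
  {g : EuclideanSpace ℝ (Fin n) → Fin m → Matrix (Fin n) (Fin d) ℝ}
  {φ : Fin m → ℝ → ℝ} {hlev : ℝ → ℝ} {Q : Matrix (Fin n) (Fin n) ℝ}

theorem lintegral_emStep_le (hB : IsBrownianMotion P B) (hfg : IsLocallyLipschitz f g)
    (hQ : Q.PosDef) {s Δ : ℝ} (hs : 0 < s) (hΔ : 0 < Δ) {i : Fin m} {R : ℝ≥0∞} {a : ℝ}
    (hone : ∀ x, ∫⁻ b, ENNReal.ofReal (quad Q (emStep f g Δ i (trunc R x) (√Δ • b)) ^ s)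
        ∂(stdGaussian (EuclideanSpace ℝ (Fin d))) ≤ ENNReal.ofReal (quad Q (trunc R x) ^ s * a))
    {X : Ω → EuclideanSpace ℝ (Fin n)} (hX : Measurable X) {k : ℕ}
    (hind : IndepFun X (increment B Δ.toNNReal k) P) :
    ∫⁻ ω, ENNReal.ofReal (quad Q (emStep f g Δ i (trunc R (X ω))
        (increment B Δ.toNNReal k ω)) ^ s) ∂P
      ≤ (∫⁻ ω, ENNReal.ofReal (quad Q (X ω) ^ s) ∂P) * ENNReal.ofReal a := by
  have hqm : Measurable (fun z => ENNReal.ofReal (quad Q z ^ s)) :=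
    ((continuous_quad Q).measurable.pow_const s).ennreal_ofReal
  have hτ : ((Δ.toNNReal : ℝ≥0) : ℝ) = Δ := Real.coe_toNNReal Δ hΔ.le
  have h1 : Measurable fun z : EuclideanSpace ℝ (Fin n) × EuclideanSpace ℝ (Fin d) =>
      (trunc R z.1, z.2) := ((measurable_trunc R).comp measurable_fst).prodMk measurable_snd
  have hF : Measurable fun z : EuclideanSpace ℝ (Fin n) × EuclideanSpace ℝ (Fin d) =>
      ENNReal.ofReal (quad Q (emStep f g Δ i (trunc R z.1) z.2) ^ s) := by
    have h3 := hqm.comp ((hfg.measurable_emStep Δ i).comp h1)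
    simp only [Function.comp_def] at h3
    exact h3
  have h2 := lintegral_indepFun hX (hB.measurable_increment Δ.toNNReal k) hind hF
  dsimp only at h2
  rw [h2]
  have hXV : Measurable fun ω => ENNReal.ofReal (quad Q (X ω) ^ s) := hqm.comp hX
  rw [← lintegral_mul_const _ hXV, hB.map_increment _ (by simpa using hΔ), hτ]
  refine lintegral_mono fun ω => ?_
  have hF' : Measurable fun b : EuclideanSpace ℝ (Fin d) =>
      ENNReal.ofReal (quad Q (emStep f g Δ i (trunc R (X ω)) b) ^ s) := by
    have h3 := hF.comp (measurable_prodMk_left (x := X ω))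
    simp only [Function.comp_def] at h3
    exact h3
  rw [lintegral_map hF' (by fun_prop)]
  refine (hone (X ω)).trans ?_
  rw [ENNReal.ofReal_mul (Real.rpow_nonneg (quad_nonneg hQ _) _)]
  exact mul_le_mul_left (ENNReal.ofReal_le_ofReal
    (Real.rpow_le_rpow (quad_nonneg hQ _) (quad_trunc_le hQ _ _) hs.le)) _

/-- Here `ρ` is a fixed sequence of states. Each step contributes one factor `a`, and its truncation
is dropped because it decreases the form. -/
theorem lintegral_preScheme_le (hB : IsBrownianMotion P B) (hfg : IsLocallyLipschitz f g)
    (hQ : Q.PosDef) {s Δ : ℝ} (hs : 0 < s) (hΔ : 0 < Δ) {a : Fin m → ℝ}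
    (hone : ∀ i x, ∫⁻ b, ENNReal.ofReal (quad Q (emStep f g Δ i
        (trunc (truncRadius (φ i) (hlev Δ)) x) (√Δ • b)) ^ s)
        ∂(stdGaussian (EuclideanSpace ℝ (Fin d)))
      ≤ ENNReal.ofReal (quad Q (trunc (truncRadius (φ i) (hlev Δ)) x) ^ s * a i))
    (x₀ : EuclideanSpace ℝ (Fin n)) (ρ : ℕ → Fin m) (k : ℕ) :
    ∫⁻ ω, ENNReal.ofReal (quad Q (preScheme f g φ hlev x₀ Δ ρ
        (fun j => increment B Δ.toNNReal j ω) k) ^ s) ∂P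
      ≤ ENNReal.ofReal (quad Q x₀ ^ s) * ∏ j ∈ Finset.range k, ENNReal.ofReal (a (ρ j)) := by
  induction k with
  | zero => simp [preScheme]
  | succ k ih =>
    have hXm : Measurable fun b : ℕ → EuclideanSpace ℝ (Fin d) =>
        preScheme f g φ hlev x₀ Δ ρ b k := by
      have h1 : Measurable fun b : ℕ → EuclideanSpace ℝ (Fin d) => (ρ, b) :=
        measurable_const.prodMk measurable_id
      exact (hfg.measurable_preScheme φ hlev x₀ Δ k).comp h1
    have hind := hB.indepFun_increment Δ.toNNReal k hXm fun b b' h =>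
      preScheme_congr φ hlev x₀ Δ ρ h
    have hbm : Measurable fun ω => fun j => increment B Δ.toNNReal j ω :=
      measurable_pi_lambda _ fun j => hB.measurable_increment _ j
    have hXω : Measurable fun ω => preScheme f g φ hlev x₀ Δ ρ
        (fun j => increment B Δ.toNNReal j ω) k := hXm.comp hbm
    have h1 := lintegral_emStep_le hB hfg hQ hs hΔ (hone (ρ k)) hXω hind
    rw [Finset.prod_range_succ, ← mul_assoc]
    exact h1.trans (mul_le_mul_left ih _)

/-- The moments of the scheme are controlled by a functional of the Markov chain alone. -/
theorem lintegral_scheme_le (hB : IsBrownianMotion P B) (hfg : IsLocallyLipschitz f g)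
    (hQ : Q.PosDef) {Γ : Matrix (Fin m) (Fin m) ℝ} {ℓ : Fin m} {r : ℝ≥0 → Ω → Fin m}
    (hr : IsMarkovChain P Γ ℓ r)
    (hindep : IndepFun (fun ω t => B t ω) (fun ω t => r t ω) P)
    {s Δ : ℝ} (hs : 0 < s) (hΔ : 0 < Δ) {a : Fin m → ℝ}
    (hone : ∀ i x, ∫⁻ b, ENNReal.ofReal (quad Q (emStep f g Δ i
        (trunc (truncRadius (φ i) (hlev Δ)) x) (√Δ • b)) ^ s)
        ∂(stdGaussian (EuclideanSpace ℝ (Fin d)))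
      ≤ ENNReal.ofReal (quad Q (trunc (truncRadius (φ i) (hlev Δ)) x) ^ s * a i))
    (x₀ : EuclideanSpace ℝ (Fin n)) (k : ℕ) :
    ∫⁻ ω, ENNReal.ofReal (quad Q (scheme f g φ hlev x₀ r B Δ k ω) ^ s) ∂P
      ≤ ENNReal.ofReal (quad Q x₀ ^ s)
        * ∫⁻ ω, ∏ j ∈ Finset.range k, ENNReal.ofReal (a (r (j * Δ.toNNReal) ω)) ∂P := by
  have hqm : Measurable (fun z => ENNReal.ofReal (quad Q z ^ s)) :=
    ((continuous_quad Q).measurable.pow_const s).ennreal_ofReal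
  have hF : Measurable fun z : (ℕ → Fin m) × (ℕ → EuclideanSpace ℝ (Fin d)) =>
      ENNReal.ofReal (quad Q (preScheme f g φ hlev x₀ Δ z.1 z.2 k) ^ s) := by
    have h1 := hqm.comp (hfg.measurable_preScheme φ hlev x₀ Δ k)
    rw [Function.comp_def] at h1
    exact h1
  have hb : Measurable fun ω => fun j => increment B Δ.toNNReal j ω :=
    measurable_pi_lambda _ fun j => hB.measurable_increment _ j
  have hrm : Measurable fun ω => fun j : ℕ => r (j * Δ.toNNReal) ω :=
    measurable_pi_lambda _ fun j => hr.measurable _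
  have hind : IndepFun (fun ω => fun j : ℕ => r (j * Δ.toNNReal) ω)
      (fun ω => fun j => increment B Δ.toNNReal j ω) P := by
    have h1 : Measurable fun (path : ℝ≥0 → EuclideanSpace ℝ (Fin d)) (j : ℕ) =>
        path ((j + 1) * Δ.toNNReal) - path (j * Δ.toNNReal) := by fun_prop
    have h2 : Measurable fun (path : ℝ≥0 → Fin m) (j : ℕ) => path (j * Δ.toNNReal) := by fun_prop
    exact (hindep.comp h1 h2).symm
  have h1 := lintegral_indepFun hrm hb hind hF
  have hprod : Measurable fun ω => ∏ j ∈ Finset.range k,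
      ENNReal.ofReal (a (r (j * Δ.toNNReal) ω)) :=
    Finset.measurable_prod _ fun j _ =>
      (measurable_of_finite fun i => ENNReal.ofReal (a i)).comp (hr.measurable _)
  calc ∫⁻ ω, ENNReal.ofReal (quad Q (scheme f g φ hlev x₀ r B Δ k ω) ^ s) ∂P
      ≤ ∫⁻ ω, ENNReal.ofReal (quad Q (preScheme f g φ hlev x₀ Δ
          (fun j : ℕ => r (j * Δ.toNNReal) ω)
          (fun j => increment B Δ.toNNReal j ω) k) ^ s) ∂P :=
        lintegral_mono fun ω => ENNReal.ofReal_le_ofReal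
          (Real.rpow_le_rpow (quad_nonneg hQ _) (quad_trunc_le hQ _ _) hs.le)
    _ = _ := h1
    _ ≤ ∫⁻ ω, ENNReal.ofReal (quad Q x₀ ^ s)
        * ∏ j ∈ Finset.range k, ENNReal.ofReal (a (r (j * Δ.toNNReal) ω)) ∂P := by
        refine lintegral_mono fun ω => ?_
        have hF' : Measurable fun b : ℕ → EuclideanSpace ℝ (Fin d) => ENNReal.ofReal
            (quad Q (preScheme f g φ hlev x₀ Δ (fun j : ℕ => r (j * Δ.toNNReal) ω) b k) ^ s) := by
          have h2 := hF.comp (measurable_prodMk_left (x := fun j : ℕ => r (j * Δ.toNNReal) ω))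
          rw [Function.comp_def] at h2
          exact h2
        rw [lintegral_map hF' hb]
        exact lintegral_preScheme_le hB hfg hQ hs hΔ hone x₀ _ k
    _ = _ := lintegral_const_mul _ hprod

end Moments

/-! ### From exponential bounds to logarithmic rates. -/

section Rates

theorem limsup_log_div_le {u : ℕ → ℝ≥0∞} {Δ κ : ℝ} (hΔ : 0 < Δ)
    (h : ∀ᶠ k : ℕ in atTop, u k ≤ ENNReal.ofReal (Real.exp (-κ * (k * Δ)))) :
    limsup (fun k : ℕ => ENNReal.log (u k) / ((k * Δ : ℝ) : EReal)) atTop ≤ ((-κ : ℝ) : EReal) := by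
  refine limsup_le_of_le (by isBoundedDefault) ?_
  filter_upwards [h, eventually_gt_atTop 0] with k hk hk0
  have hpos : 0 < (k : ℝ) * Δ := by positivity
  have h1 : ENNReal.log (u k) ≤ ((-κ * (k * Δ) : ℝ) : EReal) := by
    refine (ENNReal.log_monotone hk).trans_eq ?_
    rw [ENNReal.log_ofReal_of_pos (Real.exp_pos _), Real.log_exp]
  rw [EReal.div_le_iff_le_mul (by exact_mod_cast hpos) (EReal.coe_ne_top _)]
  exact h1.trans_eq (by rw [← EReal.coe_mul, mul_comm])

theorem eventually_le_exp {C κ κ' Δ : ℝ} (hΔ : 0 < Δ) (hκ : κ' < κ) :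
    ∀ᶠ k : ℕ in atTop, C * Real.exp (-κ * Δ) ^ k ≤ Real.exp (-κ' * (k * Δ)) := by
  have h1 : Tendsto (fun k : ℕ => C * Real.exp (-(κ - κ') * Δ) ^ k) atTop (𝓝 (C * 0)) :=
    (tendsto_pow_atTop_nhds_zero_of_lt_one (Real.exp_pos _).le
      (Real.exp_lt_one_iff.2 (by nlinarith))).const_mul C
  rw [mul_zero] at h1
  filter_upwards [h1.eventually (gt_mem_nhds one_pos)] with k hk
  have h2 : Real.exp (-κ * Δ) ^ k
      = Real.exp (-(κ - κ') * Δ) ^ k * Real.exp (-κ' * (k * Δ)) := by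
    rw [← Real.exp_nat_mul, ← Real.exp_nat_mul, ← Real.exp_add]; congr 1; ring
  rw [h2, ← mul_assoc]
  exact mul_le_of_le_one_left (Real.exp_pos _).le hk.le

/-- Exponential decay of the `p`-th moments gives almost sure exponential decay at any smaller
rate. -/
theorem ae_eventually_le_exp {Ω : Type*} [MeasurableSpace Ω] {P : Measure Ω}
    {X : ℕ → Ω → ℝ≥0∞} (hX : ∀ k, Measurable (X k)) {C κ κ' Δ p : ℝ} (hΔ : 0 < Δ) (hκ : κ' < κ)
    (hp : 0 < p)
    (h : ∀ k : ℕ, ∫⁻ ω, X k ω ^ p ∂P ≤ ENNReal.ofReal (C * Real.exp (-κ * Δ) ^ k)) :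
    ∀ᵐ ω ∂P, ∀ᶠ k : ℕ in atTop, X k ω ≤ ENNReal.ofReal (Real.exp (-(κ' / p) * (k * Δ))) := by
  -- The gap between `κ'` and `κ` makes the expectations of `w k` geometrically summable. Hence `∑ w
  -- k` is almost surely finite and eventually `w k < 1`, which is the claimed bound.
  set w : ℕ → Ω → ℝ≥0∞ := fun k ω => ENNReal.ofReal (Real.exp (κ' * (k * Δ))) * X k ω ^ p with hw
  have hwm : ∀ k, Measurable (w k) := fun k => ((hX k).pow_const p).const_mul _
  have hsum : ∫⁻ ω, ∑' k, w k ω ∂P ≠ ⊤ := by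
    rw [lintegral_tsum fun k => (hwm k).aemeasurable]
    have hle : ∀ k, ∫⁻ ω, w k ω ∂P ≤ ENNReal.ofReal (|C| * Real.exp (-(κ - κ') * Δ) ^ k) := by
      intro k
      rw [hw, lintegral_const_mul _ ((hX k).pow_const p)]
      refine (mul_le_mul_right (h k) _).trans ?_
      rw [← ENNReal.ofReal_mul (Real.exp_pos _).le]
      refine ENNReal.ofReal_le_ofReal ?_
      have h2 : Real.exp (κ' * (k * Δ)) * Real.exp (-κ * Δ) ^ k
          = Real.exp (-(κ - κ') * Δ) ^ k := by
        rw [← Real.exp_nat_mul, ← Real.exp_nat_mul, ← Real.exp_add]; congr 1; ring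
      calc _ = C * (Real.exp (κ' * (k * Δ)) * Real.exp (-κ * Δ) ^ k) := by ring
        _ ≤ _ := by rw [h2]; exact mul_le_mul_of_nonneg_right (le_abs_self C) (by positivity)
    have hs : Summable fun k : ℕ => |C| * Real.exp (-(κ - κ') * Δ) ^ k :=
      (summable_geometric_of_lt_one (Real.exp_pos _).le
        (Real.exp_lt_one_iff.2 (by nlinarith))).mul_left _
    refine ne_top_of_le_ne_top ?_ (ENNReal.tsum_le_tsum hle)
    rw [← ENNReal.ofReal_tsum_of_nonneg (fun k => by positivity) hs]
    exact ENNReal.ofReal_ne_top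
  filter_upwards [ae_lt_top (Measurable.tsum hwm) hsum] with ω hω
  have h1 := ENNReal.tendsto_atTop_zero_of_tsum_ne_top hω.ne
  filter_upwards [h1.eventually (gt_mem_nhds (show (0 : ℝ≥0∞) < 1 by simp))] with k hk
  have hk' : ENNReal.ofReal (Real.exp (κ' * (k * Δ))) * X k ω ^ p ≤ 1 := hk.le
  have h2 : X k ω ^ p ≤ ENNReal.ofReal (Real.exp (-(κ' / p) * (k * Δ))) ^ p := by
    have h3 : ENNReal.ofReal (Real.exp (-(κ' / p) * (k * Δ))) ^ p
        = (ENNReal.ofReal (Real.exp (κ' * (k * Δ))))⁻¹ := by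
      rw [ENNReal.ofReal_rpow_of_pos (Real.exp_pos _), ← ENNReal.ofReal_inv_of_pos (Real.exp_pos _),
        ← Real.exp_neg, ← Real.exp_mul]
      congr 2; field_simp
    rw [h3, ENNReal.le_inv_iff_mul_le, mul_comm]
    exact hk'
  exact (ENNReal.rpow_le_rpow_iff hp).1 h2

end Rates

/-! ### Exponential decay of the moments of the scheme. -/

section Decay

variable {Ω : Type*} [MeasurableSpace Ω] {P : Measure Ω} {n d m : ℕ}
  {B : ℝ≥0 → Ω → EuclideanSpace ℝ (Fin d)}
  {f : EuclideanSpace ℝ (Fin n) → Fin m → EuclideanSpace ℝ (Fin n)}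
  {g : EuclideanSpace ℝ (Fin n) → Fin m → Matrix (Fin n) (Fin d) ℝ}
  {φ : Fin m → ℝ → ℝ} {hlev : ℝ → ℝ} {Q : Matrix (Fin n) (Fin n) ℝ}
  {Γ : Matrix (Fin m) (Fin m) ℝ} {ℓ : Fin m} {r : ℝ≥0 → Ω → Fin m}

theorem measurable_trunc_comp (R : Fin m → ℝ≥0∞) {I : Ω → Fin m} (hI : Measurable I)
    {X : Ω → EuclideanSpace ℝ (Fin n)} (hX : Measurable X) :
    Measurable fun ω => trunc (R (I ω)) (X ω) := by
  have hT : Measurable fun y : Fin m × EuclideanSpace ℝ (Fin n) => trunc (R y.1) y.2 :=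
    measurable_from_prod_countable_right fun i => measurable_trunc (R i)
  have h := hT.comp (hI.prodMk hX)
  simp only [Function.comp_def] at h
  exact h

theorem measurable_scheme (hB : IsBrownianMotion P B) (hfg : IsLocallyLipschitz f g)
    (hr : IsMarkovChain P Γ ℓ r) (x₀ : EuclideanSpace ℝ (Fin n)) (Δ : ℝ) (k : ℕ) :
    Measurable (scheme f g φ hlev x₀ r B Δ k) := by
  have hb : Measurable fun ω => fun j => increment B Δ.toNNReal j ω :=
    measurable_pi_lambda _ fun j => hB.measurable_increment _ j
  have hrm : Measurable fun ω => fun j : ℕ => r (j * Δ.toNNReal) ω :=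
    measurable_pi_lambda _ fun j => hr.measurable _
  have hX := (hfg.measurable_preScheme φ hlev x₀ Δ k).comp (hrm.prodMk hb)
  rw [Function.comp_def] at hX
  dsimp only at hX
  exact measurable_trunc_comp (fun i => truncRadius (φ i) (hlev Δ))
    (hr.measurable (k * Δ.toNNReal)) hX

/-- If a positive vector `ζ` is superharmonic for the weighted chain with decay factor `κ` per step,
then the moments of the scheme decay like `κ ^ k`. -/
theorem exists_lintegral_scheme_le [IsProbabilityMeasure P] (hB : IsBrownianMotion P B)
    (hfg : IsLocallyLipschitz f g)
    (hQ : Q.PosDef) (hr : IsMarkovChain P Γ ℓ r)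
    (hindep : IndepFun (fun ω t => B t ω) (fun ω t => r t ω) P)
    {s Δ : ℝ} (hs : 0 < s) (hΔ : 0 < Δ) {a ζ : Fin m → ℝ}
    (hone : ∀ i x, ∫⁻ b, ENNReal.ofReal (quad Q (emStep f g Δ i
        (trunc (truncRadius (φ i) (hlev Δ)) x) (√Δ • b)) ^ s)
        ∂(stdGaussian (EuclideanSpace ℝ (Fin d)))
      ≤ ENNReal.ofReal (quad Q (trunc (truncRadius (φ i) (hlev Δ)) x) ^ s * a i))
    (hζ : ∀ i, 0 < ζ i) {κ : ℝ} (hκ : 0 ≤ κ)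
    (h : ∀ i, a i * (NormedSpace.exp (Δ • Γ) *ᵥ ζ) i ≤ ζ i * κ) (x₀ : EuclideanSpace ℝ (Fin n)) :
    ∃ C : ℝ, ∀ k : ℕ, ∫⁻ ω, ‖scheme f g φ hlev x₀ r B Δ k ω‖ₑ ^ (2 * s) ∂P
      ≤ ENNReal.ofReal (C * κ ^ k) := by
  obtain ⟨c, hc, hcq⟩ := exists_le_quad hQ
  have : Nonempty (Fin m) := ⟨ℓ⟩
  obtain ⟨i₀, hi₀⟩ := Finite.exists_min ζ
  have hD : ∀ i, ζ i ≤ ∑ j, ζ j := fun i =>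
    Finset.single_le_sum (fun j _ => (hζ j).le) (Finset.mem_univ i)
  -- The factors `a i` may be negative, and `ENNReal.ofReal` keeps only their positive parts. These
  -- satisfy the same inequality because its right side is nonnegative.
  have hmax : ∀ i, max (a i) 0 * (NormedSpace.exp (((Δ.toNNReal : ℝ≥0) : ℝ) • Γ) *ᵥ ζ) i
      ≤ ζ i * κ := fun i => by
    rw [Real.coe_toNNReal Δ hΔ.le]
    rcases le_total (a i) 0 with h0 | h0
    · rw [max_eq_right h0, zero_mul]; exact mul_nonneg (hζ i).le hκ
    · rw [max_eq_left h0]; exact h i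
  -- The factor `c⁻¹ ^ s` compares the norm with the form; `(ζ i₀)⁻¹` inserts the weight `ζ` by its
  -- minimum, and `∑ j, ζ j` bounds that weight at time zero.
  refine ⟨c⁻¹ ^ s * (quad Q x₀ ^ s * ((ζ i₀)⁻¹ * ∑ j, ζ j)), fun k => ?_⟩
  have h1 := lintegral_scheme_le (P := P) hB hfg hQ hr hindep hs hΔ hone x₀ k
  have h2 : ∫⁻ ω, ∏ j ∈ Finset.range k, ENNReal.ofReal (a (r (j * Δ.toNNReal) ω)) ∂P
      ≤ ENNReal.ofReal ((ζ i₀)⁻¹ * ((∑ j, ζ j) * κ ^ k)) := by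
    have h3 := hr.integral_prod_le Δ.toNNReal (a := fun i => max (a i) 0)
      (fun i => le_max_right _ _) hD hκ hmax k
    have hint := hr.integrable_prod Δ.toNNReal (fun i => max (a i) 0) ζ k
    have hpos : ∀ ω, 0 ≤ ∏ j ∈ Finset.range k, max (a (r (j * Δ.toNNReal) ω)) 0 := fun ω =>
      Finset.prod_nonneg fun _ _ => le_max_right _ _
    have hinv : 0 ≤ (ζ i₀)⁻¹ := (inv_pos.2 (hζ i₀)).le
    calc _ ≤ ∫⁻ ω, ENNReal.ofReal ((ζ i₀)⁻¹ *
          ((∏ j ∈ Finset.range k, max (a (r (j * Δ.toNNReal) ω)) 0)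
            * ζ (r (k * Δ.toNNReal) ω))) ∂P := by
          refine lintegral_mono fun ω => ?_
          have h4 : ∏ j ∈ Finset.range k, ENNReal.ofReal (a (r (j * Δ.toNNReal) ω))
              = ENNReal.ofReal (∏ j ∈ Finset.range k, max (a (r (j * Δ.toNNReal) ω)) 0) := by
            rw [ENNReal.ofReal_prod_of_nonneg fun _ _ => le_max_right _ _]
            refine Finset.prod_congr rfl fun j _ => ?_
            rw [ENNReal.ofReal_max]; simp
          dsimp only
          rw [h4]
          refine ENNReal.ofReal_le_ofReal ?_
          have h5 : 1 ≤ (ζ i₀)⁻¹ * ζ (r (k * Δ.toNNReal) ω) := by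
            rw [inv_mul_eq_div, one_le_div (hζ i₀)]; exact hi₀ _
          calc _ ≤ (∏ j ∈ Finset.range k, max (a (r (j * Δ.toNNReal) ω)) 0)
                * ((ζ i₀)⁻¹ * ζ (r (k * Δ.toNNReal) ω)) := le_mul_of_one_le_right (hpos ω) h5
            _ = _ := by ring
      _ = ENNReal.ofReal (∫ ω, (ζ i₀)⁻¹ *
          ((∏ j ∈ Finset.range k, max (a (r (j * Δ.toNNReal) ω)) 0)
            * ζ (r (k * Δ.toNNReal) ω)) ∂P) := by
          rw [ofReal_integral_eq_lintegral_ofReal (hint.const_mul _)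
            (Eventually.of_forall fun ω => mul_nonneg hinv (mul_nonneg (hpos ω) (hζ _).le))]
      _ ≤ _ := by
          rw [integral_const_mul]
          exact ENNReal.ofReal_le_ofReal (mul_le_mul_of_nonneg_left h3 hinv)
  have h3 : ∀ z : EuclideanSpace ℝ (Fin n),
      ‖z‖ₑ ^ (2 * s) ≤ ENNReal.ofReal (c⁻¹ ^ s) * ENNReal.ofReal (quad Q z ^ s) := fun z => by
    rw [← ofReal_norm, ENNReal.ofReal_rpow_of_nonneg (norm_nonneg _) (by positivity),
      ← ENNReal.ofReal_mul (by positivity), ← Real.mul_rpow (by positivity) (quad_nonneg hQ z),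
      Real.rpow_mul (norm_nonneg _)]
    refine ENNReal.ofReal_le_ofReal (Real.rpow_le_rpow (by positivity) ?_ hs.le)
    rw [inv_mul_eq_div, le_div_iff₀ hc, mul_comm]
    exact_mod_cast hcq z
  calc ∫⁻ ω, ‖scheme f g φ hlev x₀ r B Δ k ω‖ₑ ^ (2 * s) ∂P
      ≤ ∫⁻ ω, ENNReal.ofReal (c⁻¹ ^ s)
        * ENNReal.ofReal (quad Q (scheme f g φ hlev x₀ r B Δ k ω) ^ s) ∂P :=
        lintegral_mono fun ω => h3 _
    _ ≤ ENNReal.ofReal (c⁻¹ ^ s) * (ENNReal.ofReal (quad Q x₀ ^ s)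
        * ENNReal.ofReal ((ζ i₀)⁻¹ * ((∑ j, ζ j) * κ ^ k))) := by
        rw [lintegral_const_mul' _ _ ENNReal.ofReal_ne_top]
        exact mul_le_mul_right (h1.trans (mul_le_mul_right h2 _)) _
    _ = _ := by
        have hq := quad_nonneg hQ x₀
        rw [← ENNReal.ofReal_mul (by positivity), ← ENNReal.ofReal_mul (by positivity)]
        congr 1; ring

end Decay

/-- `-eta` is the spectral abscissa, and adding a diagonal matrix leaves the nonnegative
off-diagonal entries of `Γ` unchanged. -/
theorem exists_superharmonic {m : ℕ} {Γ : Matrix (Fin m) (Fin m) ℝ} (hΓ : IsGenerator Γ) (p : ℝ)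
    (u : Fin m → ℝ) {lam : ℝ} (hlam : -eta Γ p u < lam) :
    ∃ ζ : Fin m → ℝ, (∀ i, 0 < ζ i) ∧
      ∀ i, ((Γ + Matrix.diagonal fun j => p / 2 * u j) *ᵥ ζ) i ≤ lam * ζ i := by
  have hd : (Matrix.diagonal fun j => p / 2 * u j) = (p / 2) • Matrix.diagonal u := by
    rw [← Matrix.diagonal_smul]; rfl
  rw [hd]
  refine exists_pos_mulVec_le _ (fun i j hij => ?_) lam fun z hz => ?_
  · simpa [Matrix.diagonal_apply_ne _ hij] using hΓ.nonneg i j hij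
  · refine lt_of_le_of_lt ?_ hlam
    rw [eta, neg_neg]
    exact le_csSup ((Matrix.finite_spectrum _).image _).bddAbove ⟨z, hz, rfl⟩

end SwitchingEM
end

/-! ### The stability theorem. -/

open SwitchingEM
/-- Logarithms are taken in `[-∞, ∞]`, with `log 0 = -∞`. -/
theorem corollary4p9 {n d m : ℕ} {Ω : Type*} [MeasurableSpace Ω]
    (P : Measure Ω) [IsProbabilityMeasure P]
    (B : ℝ≥0 → Ω → EuclideanSpace ℝ (Fin d)) (hB : IsBrownianMotion P B)
    (Γ : Matrix (Fin m) (Fin m) ℝ) (hΓ : IsGenerator Γ) (hirr : IsIrreducibleGenerator Γ)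
    (ℓ : Fin m) (r : ℝ≥0 → Ω → Fin m) (hr : IsMarkovChain P Γ ℓ r)
    (hindep : IndepFun (fun ω t => B t ω) (fun ω t => r t ω) P)
    (x₀ : EuclideanSpace ℝ (Fin n))
    (f : EuclideanSpace ℝ (Fin n) → Fin m → EuclideanSpace ℝ (Fin n))
    (g : EuclideanSpace ℝ (Fin n) → Fin m → Matrix (Fin n) (Fin d) ℝ)
    (hfg : IsLocallyLipschitz f g)
    (Q : Matrix (Fin n) (Fin n) ℝ) (β : Fin m → ℝ) (ρ : ℝ)
    (hstab : StabilityAssumption f g Q β ρ)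
    (π : Fin m → ℝ) (hπ : IsStationaryVector Γ π) (hπβ : ∑ i, π i * β i < 0)
    (pstar : EReal) (hpstar : IsCriticalExponent Γ β pstar)
    (φ : Fin m → ℝ → ℝ) (hφ : IsLipschitzControl f g φ)
    (h : ℝ → ℝ) (hh : IsTruncationLevel f g φ x₀ h)
    (p : ℝ) (hp : 0 < p) (hp_lt : (p : EReal) < pstar) (hp_le : p ≤ ρ)
    (ϱ : ℝ) (hϱ : 0 < ϱ) (hϱ_lt : ϱ < eta Γ p β) :
    ∃ Δs : ℝ, 0 < Δs ∧ Δs ≤ 1 ∧ ∀ Δ : ℝ, 0 < Δ → Δ ≤ Δs →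
      (limsup (fun k : ℕ =>
          ENNReal.log (∫⁻ ω, ‖scheme f g φ h x₀ r B Δ k ω‖ₑ ^ p ∂P) / ((k * Δ : ℝ) : EReal)) atTop
            ≤ ((-(eta Γ p β - ϱ) : ℝ) : EReal) ∧
        -(eta Γ p β - ϱ) < 0) ∧
      ∀ᵐ ω ∂P, limsup (fun k : ℕ =>
          ENNReal.log ‖scheme f g φ h x₀ r B Δ k ω‖ₑ / ((k * Δ : ℝ) : EReal)) atTop
            ≤ ((-((eta Γ p β - ϱ) / p) : ℝ) : EReal) := by
  obtain ⟨θ, hθ, -, K, hK, hrate⟩ := hh.rate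
  have hs : 0 < p / 2 := by positivity
  -- The loss `ϱ` is spent in stages: `ϱ / 4` to lie strictly above the spectrum, up to `ϱ / 2` to
  -- absorb `C Δ^{1+2θ}` and the error of `e^{ΔΓ}`, and the rest to absorb the constant prefactor
  -- and to pass to almost sure decay.
  obtain ⟨ζ, hζ, hAζ⟩ := exists_superharmonic hΓ p β
    (lam := -(eta Γ p β - ϱ / 4)) (by linarith)
  obtain ⟨C, -, hC⟩ := exists_lintegral_quad_rpow_le (d := d) hstab.Q_posDef hs
    (by linarith : 2 * (p / 2) ≤ ρ) hK.le hθ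
  obtain ⟨δ, hδ, hstep⟩ := exists_forall_mul_exp_mulVec_le Γ (fun j => p / 2 * β j) ζ hζ
    (by linarith : -(eta Γ p β - ϱ / 4) < -(eta Γ p β - ϱ / 2)) hAζ C (1 + 2 * θ) (by linarith)
  -- Halving `δ` allows `Δ = Δs`, since the step bound needs `Δ < δ`.
  refine ⟨min (δ / 2) 1, by positivity, min_le_right _ _, fun Δ hΔ hΔs => ?_⟩
  have hΔ1 : Δ ≤ 1 := hΔs.trans (min_le_right _ _)
  have hΔδ : Δ < δ := (hΔs.trans (min_le_left _ _)).trans_lt (by linarith)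
  have hlevel : ∀ i, φ i (max ‖x₀‖ 1) ≤ h Δ := hh.range Δ ⟨hΔ, hΔ1⟩
  have hH : 0 ≤ h Δ := (hφ.nonneg ℓ _ (by positivity)).trans (hlevel ℓ)
  have hone : ∀ i x, ∫⁻ b, ENNReal.ofReal (quad Q (emStep f g Δ i
        (trunc (truncRadius (φ i) (h Δ)) x) (√Δ • b)) ^ (p / 2))
        ∂(stdGaussian (EuclideanSpace ℝ (Fin d)))
      ≤ ENNReal.ofReal (quad Q (trunc (truncRadius (φ i) (h Δ)) x) ^ (p / 2)
        * (1 + p / 2 * β i * Δ + C * Δ ^ (1 + 2 * θ))) := fun i x => by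
    obtain ⟨hf, hg⟩ := hφ.growth_trunc hstab.f_zero hstab.g_zero (le_max_right _ _) i (hlevel i) x
    exact hC Δ (h Δ) (β i) _ _ _ hΔ hΔ1 hH (hrate Δ ⟨hΔ, hΔ1⟩) hf hg (hstab.bound _ i)
  obtain ⟨D, hD⟩ := exists_lintegral_scheme_le hB hfg hstab.Q_posDef hr hindep hs hΔ hone hζ
    (Real.exp_pos (-(eta Γ p β - ϱ / 2) * Δ)).le (hstep Δ hΔ hΔδ) x₀
  rw [mul_div_cancel₀ p two_ne_zero] at hD
  have hrates : eta Γ p β - ϱ < eta Γ p β - ϱ / 2 := by linarith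
  refine ⟨⟨limsup_log_div_le hΔ ?_, by linarith⟩, ?_⟩
  · filter_upwards [eventually_le_exp (C := D) hΔ hrates] with k hk
    exact (hD k).trans (ENNReal.ofReal_le_ofReal hk)
  · filter_upwards [ae_eventually_le_exp
      (fun k => (measurable_scheme hB hfg hr x₀ Δ k).enorm) hΔ hrates hp hD] with ω hω
    exact limsup_log_div_le hΔ hω
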